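/- Consider the following game between Forecaster, Skeptic and Reality (the simplified predictably unbounded forecasting game) with initial capital $\mathcal K_0=\alpha>0$. In each round $n=1,2,\dots$, Forecaster announces $c_n\ge 0$, then Skeptic announces $M_n\in\mathbb R$, then Reality announces $x_n\in[-c_n,c_n]$, and Skeptic's capital becomes $\mathcal K_n=\mathcal K_{n-1}+M_nx_n$. A strategy of Skeptic determines $M_n$ as a function of $c_1,x_1,\dots,c_{n-1},x_{n-1},c_n$. Skeptic *can force* an event $E$ (a property of the path $(c_1,x_1,c_2,x_2,\dots)$) if he has a strategy such that $\mathcal K_n\ge 0$ for all $n$ on every path, and $\mathcal K_n\to\infty$ on every path on which $E$ fails. Put $S_n=\sum_{i=1}^n x_i$, $A_n^2=\sum_{i=1}^n x_i^2$ and $A_n=\sqrt{A_n^2}$. Let $\psi:[1,\infty)\to(0,\infty)$ be a non-decreasing continuous function and let $$I(\psi)=\int_1^\infty \psi(\lambda)\,e^{-\psi(\lambda)^2/2}\,\frac{d\lambda}{\lambda}\in[0,\infty].$$ **Theorem.** Let $\alpha>0$. (1) If $I(\psi)<\infty$, then Skeptic can force $$A_n^2\to\infty\ \text{ and }\ \limsup_{n\to\infty}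 c_n\frac{\psi(A_n^2)^3}{A_n}<\infty\quad\Longrightarrow\quad S_n<A_n\psi(A_n^2)\ \text{ for all sufficiently large } n.$$ (2) If $I(\psi)=\infty$ and $\psi(\lambda)\to\infty$ as $\lambda\to\infty$, then Skeptic can force $$A_n^2\to\infty\ \text{ and }\ \limsup_{n\to\infty} c_n\frac{\psi(A_n^2)^3}{A_n}<\infty\quad\Longrightarrow\quad S_n\ge A_n\psi(A_n^2)\ \text{ for infinitely many } n.$$ -/

import Mathlib

/-! The simplified predictably unbounded forecasting game. Rounds are indexed from `0`:
round number `n + 1` of the protocol is the round with index `n`. -/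

namespace SPUFG

/-- A path of the game: the moves `c` of Forecaster and the moves `x` of Reality, where
Forecaster must play `c n ≥ 0` and Reality must play `x n ∈ [-c n, c n]`. -/
structure Path where
  /-- the moves of Forecaster -/
  c : ℕ → ℝ
  /-- the moves of Reality -/
  x : ℕ → ℝ
  c_nonneg : ∀ n, 0 ≤ c n
  x_mem : ∀ n, x n ∈ Set.Icc (-c n) (c n)

/-- A strategy for Skeptic: his move in round `n` is a function of the moves of Forecaster and
Reality in the earlier rounds and of the move that Forecaster has just announced. -/
def Strategy : Type := (n : ℕ) → (Fin n → ℝ × ℝ) → ℝ → ℝ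

/-- The move of Skeptic in round `n` on the path `ω`, when he follows the strategy `P`. -/
def Strategy.move (P : Strategy) (ω : Path) (n : ℕ) : ℝ :=
  P n (fun i => (ω.c i, ω.x i)) (ω.c n)

/-- The capital of Skeptic after `n` rounds on the path `ω`, when he starts with capital `α`
and follows the strategy `P`. -/
noncomputable def Strategy.capital (P : Strategy) (α : ℝ) (ω : Path) : ℕ → ℝ
  | 0 => α
  | n + 1 => P.capital α ω n + P.move ω n * ω.x n

/-- Starting with capital `α`, Skeptic can force the event `E`: he has a strategy that never
lets his capital become negative, whatever the path, and that makes his capital tend to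
infinity on every path on which `E` fails. -/
def CanForce (α : ℝ) (E : Path → Prop) : Prop :=
  ∃ P : Strategy, ∀ ω : Path,
    (∀ n, 0 ≤ P.capital α ω n) ∧
    (¬ E ω → Filter.Tendsto (P.capital α ω) Filter.atTop Filter.atTop)

/-- `S_n`, the sum of the first `n` moves of Reality. -/
noncomputable def Path.S (ω : Path) (n : ℕ) : ℝ := ∑ i ∈ Finset.range n, ω.x i

/-- `A_n ^ 2`, the sum of the squares of the first `n` moves of Reality. -/
noncomputable def Path.Asq (ω : Path) (n : ℕ) : ℝ := ∑ i ∈ Finset.range n, ω.x i ^ 2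

/-- `A_n`, the nonnegative square root of `A_n ^ 2`. -/
noncomputable def Path.A (ω : Path) (n : ℕ) : ℝ := √(ω.Asq n)

/-- `A_n ^ 2` tends to infinity and `limsup c_n ψ(A_n ^ 2) ^ 3 / A_n < ∞`. (The move with index
`n` belongs to round number `n + 1`, so that it goes together with `A_{n+1}`.) -/
def Regular (ψ : ℝ → ℝ) (ω : Path) : Prop :=
  Filter.Tendsto ω.Asq Filter.atTop Filter.atTop ∧
  Filter.limsup
    (fun n : ℕ => ((ω.c n * (ψ (ω.Asq (n + 1)) ^ 3 / ω.A (n + 1)) : ℝ) : EReal))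
    Filter.atTop < ⊤

/-- `I(ψ) = ∫_1^∞ ψ(t) exp(-ψ(t)^2/2) dt/t`, as an element of `[0, ∞]`. -/
noncomputable def integralI (ψ : ℝ → ℝ) : ENNReal :=
  ∫⁻ t in Set.Ici (1 : ℝ), ENNReal.ofReal (ψ t * Real.exp (-(ψ t) ^ 2 / 2) / t)

end SPUFG

/-! Betting the fraction `γ` of the current capital yields about `exp (γ S - γ² A² / 2)`, with a
cubic error controlled by `γ c`. With `γ = √m / √l`, at `A² = l` and `S = √m A` this equals `exp (m
/ 2)`. The axis is cut into levels on which `ψ²` lies in `[m, m + 1)`. If `lev m` is the logarithmic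
length of a level, then `I(ψ)` is comparable to the series of `lev m * √m * exp (-m / 2)`.

Convergence: a geometric grid of ratio `exp (1 / √m)` covers level `m` with about `lev m * √m`
values of `γ`, one of which is within a constant factor of optimal. If `S ≥ A ψ` occurs in the
level, the average of these capitals reaches a constant times the reciprocal of the `m`-th term of a
summable series (`exp_le_expCap_of_le_S`). Weights slightly larger than these terms are still
summable, and infinitely many hits give infinite capital. Levels are first enlarged (`cthr`), which
caps `ψ²` at about `4 log log`, so that the rounds far below a level are negligible.

Divergence: suppose `S < A ψ` from some time on. Each level is cut into cycles of logarithmic length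
`2 √(m + 1)`. In each cycle Skeptic sells `m + 1` exponential capitals, each with weight `exp (-(m +
1) / 2)`. Under the barrier their total value is a Gaussian sum over a geometric grid, hence bounded
uniformly in `m` (`exists_cycSum_le`). By the end of the cycle it is at most half of the selling
price `cost m` (`LowerPath.cycSum_le_half_cost`). Only one cycle is under way at a time, so the loss
stays bounded, while the accumulated gains are comparable to the divergent series. A separate
strategy ensures that `S` is not too negative when a cycle starts (`canForce_cycleStartBound`).

Both halves are assembled by `canForce_of_hits`, which mixes countably many stopped strategies. -/

namespace SPUFG
open Filter Topology MeasureTheory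

/-! ### Paths, predictable bets and capital -/

lemma Path.abs_x_le (ω : Path) (n : ℕ) : |ω.x n| ≤ ω.c n :=
  abs_le.2 (ω.x_mem n)

lemma Path.sq_x_le (ω : Path) (n : ℕ) : ω.x n ^ 2 ≤ ω.c n ^ 2 :=
  sq_le_sq' (ω.x_mem n).1 (ω.x_mem n).2

lemma Path.Asq_succ (ω : Path) (n : ℕ) : ω.Asq (n + 1) = ω.Asq n + ω.x n ^ 2 :=
  Finset.sum_range_succ _ _

lemma Path.Asq_nonneg (ω : Path) (n : ℕ) : 0 ≤ ω.Asq n :=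
  Finset.sum_nonneg fun _ _ => sq_nonneg _

lemma Path.Asq_mono (ω : Path) : Monotone ω.Asq :=
  monotone_nat_of_le_succ fun n => by rw [ω.Asq_succ]; linarith [sq_nonneg (ω.x n)]

/-- The paths `ω` and `ω'` agree in the first `n` rounds. -/
def Path.Agree (n : ℕ) (ω ω' : Path) : Prop :=
  ∀ i < n, ω.c i = ω'.c i ∧ ω.x i = ω'.x i

lemma Path.Agree.mono {m n : ℕ} {ω ω' : Path} (h : Path.Agree n ω ω') (hmn : m ≤ n) :
    Path.Agree m ω ω' := fun i hi => h i (hi.trans_le hmn)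

/-- The value in round `n` depends only on the earlier rounds and on Forecaster's move. -/
def Predictable (p : Path → ℕ → ℝ) : Prop :=
  ∀ n ω ω', Path.Agree n ω ω' → ω.c n = ω'.c n → p ω n = p ω' n

/-- The value at time `n` depends only on the first `n` rounds. -/
def Adapted (K : Path → ℕ → ℝ) : Prop :=
  ∀ n ω ω', Path.Agree n ω ω' → K ω n = K ω' n

lemma adapted_Asq : Adapted Path.Asq := fun n ω ω' h =>
  Finset.sum_congr rfl fun i hi => by rw [(h i (Finset.mem_range.1 hi)).2]

/-- The capital after `n` rounds, with initial capital `K₀` and bets `p`. -/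
noncomputable def wealth (K₀ : ℝ) (p : Path → ℕ → ℝ) (ω : Path) (n : ℕ) : ℝ :=
  K₀ + ∑ i ∈ Finset.range n, p ω i * ω.x i

lemma wealth_zero (K₀ : ℝ) (p : Path → ℕ → ℝ) (ω : Path) : wealth K₀ p ω 0 = K₀ := by
  simp [wealth]

lemma wealth_succ (K₀ : ℝ) (p : Path → ℕ → ℝ) (ω : Path) (n : ℕ) :
    wealth K₀ p ω (n + 1) = wealth K₀ p ω n + p ω n * ω.x n := by
  simp [wealth, Finset.sum_range_succ, add_assoc]

lemma Predictable.wealth {p : Path → ℕ → ℝ} (hp : Predictable p) (K₀ : ℝ) :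
    Adapted (wealth K₀ p) := fun n ω ω' h => by
  unfold SPUFG.wealth
  congr 1
  refine Finset.sum_congr rfl fun i hi => ?_
  have hi' := Finset.mem_range.1 hi
  rw [hp i ω ω' (h.mono hi'.le) (h i hi').1, (h i hi').2]

/-- Bets are handled as functions of whole paths. A history is turned into a path by choosing any
compatible one, and predictability makes the choice immaterial; histories with illegal moves get the
bet `0`. -/
lemma Predictable.exists_strategy {p : Path → ℕ → ℝ} (hp : Predictable p) :
    ∃ P : Strategy, ∀ α ω n, P.capital α ω n = SPUFG.wealth α p ω n := by
  classical
  let P : Strategy := fun n h c =>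
    if H : ∃ ω : Path, (∀ i : Fin n, (ω.c i, ω.x i) = h i) ∧ ω.c n = c then p H.choose n else 0
  have hP : ∀ ω n, P.move ω n = p ω n := by
    intro ω n
    have H : ∃ ω' : Path, (∀ i : Fin n, (ω'.c i, ω'.x i) = (ω.c i, ω.x i)) ∧ ω'.c n = ω.c n :=
      ⟨ω, fun _ => rfl, rfl⟩
    have e : P.move ω n = p H.choose n := dif_pos H
    rw [e]
    refine hp n _ _ (fun i hi => ?_) H.choose_spec.2
    exact Prod.mk.inj (H.choose_spec.1 ⟨i, hi⟩)
  refine ⟨P, fun α ω n => ?_⟩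
  induction n with
  | zero => rw [wealth_zero]; rfl
  | succ n ih => rw [wealth_succ, ← ih, ← hP]; rfl

/-! ### Prudent bets, stopping and countable mixtures -/

/-- Bets that cannot make the capital negative in the present round. -/
def Prudent (K₀ : ℝ) (p : Path → ℕ → ℝ) : Prop :=
  ∀ ω n, |p ω n| * ω.c n ≤ wealth K₀ p ω n

lemma abs_bet_le (p : Path → ℕ → ℝ) (ω : Path) (n : ℕ) :
    |p ω n * ω.x n| ≤ |p ω n| * ω.c n := by
  rw [abs_mul]
  exact mul_le_mul_of_nonneg_left (ω.abs_x_le n) (abs_nonneg _)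

lemma Prudent.nonneg {K₀ : ℝ} {p : Path → ℕ → ℝ} (h : Prudent K₀ p) (ω : Path) (n : ℕ) :
    0 ≤ wealth K₀ p ω n :=
  (mul_nonneg (abs_nonneg _) (ω.c_nonneg n)).trans (h ω n)

/-- The bound does not depend on the bets, so countable mixtures with summable weights converge at
every time. -/
lemma Prudent.le_two_pow {p : Path → ℕ → ℝ} (h : Prudent 1 p) (ω : Path) (n : ℕ) :
    wealth 1 p ω n ≤ 2 ^ n := by
  induction n with
  | zero => simp [wealth_zero]
  | succ n ih =>
    rw [wealth_succ, pow_succ]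
    linarith [(abs_le.1 (abs_bet_le p ω n)).2, h ω n]

/-- Stop betting when the next bet is not prudent, or when the target `T` has been reached. -/
lemma Predictable.exists_prudent_stopped {p : Path → ℕ → ℝ} (hp : Predictable p) (T : ℝ) :
    ∃ q, Predictable q ∧ Prudent 1 q ∧ ∀ ω n, T ≤ SPUFG.wealth 1 p ω n →
      (∀ i < n, |p ω i| * ω.c i ≤ SPUFG.wealth 1 p ω i) →
      ∀ k, n ≤ k → T ≤ SPUFG.wealth 1 q ω k := by
  classical
  -- The condition runs over all `i ≤ n`, so once betting stops it never resumes and the capital is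
  -- frozen.
  let go : Path → ℕ → Prop := fun ω n =>
    ∀ i ≤ n, |p ω i| * ω.c i ≤ SPUFG.wealth 1 p ω i ∧ SPUFG.wealth 1 p ω i < T
  let q : Path → ℕ → ℝ := fun ω n => if go ω n then p ω n else 0
  have go_mono : ∀ ω m n, m ≤ n → go ω n → go ω m := fun ω m n hmn h i hi => h i (hi.trans hmn)
  have heq : ∀ ω n, (∀ i < n, go ω i) → SPUFG.wealth 1 q ω n = SPUFG.wealth 1 p ω n := by
    intro ω n h
    unfold SPUFG.wealth
    congr 1
    refine Finset.sum_congr rfl fun i hi => ?_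
    simp only [q, if_pos (h i (Finset.mem_range.1 hi))]
  have hnn : ∀ ω n, 0 ≤ SPUFG.wealth 1 q ω n := by
    intro ω n
    induction n with
    | zero => simp [wealth_zero]
    | succ n ih =>
      rw [wealth_succ]
      by_cases hg : go ω n
      · have e := heq ω n fun i hi => go_mono ω i n hi.le hg
        have e2 : q ω n = p ω n := if_pos hg
        rw [e, e2]
        linarith [(abs_le.1 (abs_bet_le p ω n)).1, (hg n le_rfl).1]
      · have e2 : q ω n = 0 := if_neg hg
        rw [e2]; linarith
  refine ⟨q, ?_, ?_, ?_⟩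
  · intro n ω ω' h hc
    have hgo : go ω n ↔ go ω' n := by
      refine forall₂_congr fun i hi => ?_
      have e1 : ω.c i = ω'.c i := by
        rcases hi.lt_or_eq with hi | rfl
        · exact (h i hi).1
        · exact hc
      rw [hp.wealth 1 i ω ω' (h.mono hi), hp i ω ω' (h.mono hi) e1, e1]
    simp only [q, hgo, hp n ω ω' h hc]
  · intro ω n
    by_cases hg : go ω n
    · have e := heq ω n fun i hi => go_mono ω i n hi.le hg
      have e2 : q ω n = p ω n := if_pos hg
      rw [e, e2]; exact (hg n le_rfl).1
    · have e2 : q ω n = 0 := if_neg hg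
      rw [e2]; simpa using hnn ω n
  · intro ω n hT hpr k hk
    have hex : ∃ n, T ≤ SPUFG.wealth 1 p ω n := ⟨n, hT⟩
    set n₀ := Nat.find hex with hn₀
    have h0 : T ≤ SPUFG.wealth 1 p ω n₀ := Nat.find_spec hex
    have hle : n₀ ≤ n := Nat.find_min' hex hT
    have hlt : ∀ i < n₀, go ω i := fun i hi j hj =>
      ⟨hpr j (by omega), not_le.1 (Nat.find_min hex (by omega : j < n₀))⟩
    have base : T ≤ SPUFG.wealth 1 q ω n₀ := by rw [heq ω n₀ hlt]; exact h0
    have hfrozen : ∀ k, n₀ ≤ k → T ≤ SPUFG.wealth 1 q ω k := by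
      intro k hk
      induction k, hk using Nat.le_induction with
      | base => exact base
      | succ k hk ih =>
        have e : q ω k = 0 := if_neg fun hg => (hg n₀ hk).2.not_ge h0
        rw [wealth_succ, e]; simpa using ih
    exact hfrozen k (hle.trans hk)

lemma wealth_tsum {q : ℕ → Path → ℕ → ℝ} (hq : ∀ k, Prudent 1 (q k)) {a : ℕ → ℝ}
    (ha : ∀ k, 0 ≤ a k) (hs : Summable a) (ω : Path) (n : ℕ) :
    Summable (fun k => a k * wealth 1 (q k) ω n) ∧
    wealth (∑' k, a k) (fun ω n => ∑' k, a k * q k ω n) ω n =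
      ∑' k, a k * wealth 1 (q k) ω n := by
  have hsum : ∀ n, Summable (fun k => a k * wealth 1 (q k) ω n) := fun n =>
    Summable.of_nonneg_of_le (fun k => mul_nonneg (ha k) ((hq k).nonneg ω n))
      (fun k => mul_le_mul_of_nonneg_left ((hq k).le_two_pow ω n) (ha k)) (hs.mul_right _)
  refine ⟨hsum n, ?_⟩
  induction n with
  | zero => simp [wealth_zero]
  | succ n ih =>
    have hb : Summable (fun k => a k * (q k ω n * ω.x n)) := by
      refine Summable.of_norm_bounded (hsum n) fun k => ?_
      rw [Real.norm_eq_abs, abs_mul, abs_of_nonneg (ha k)]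
      exact mul_le_mul_of_nonneg_left ((abs_bet_le _ ω n).trans (hq k ω n)) (ha k)
    simp only [wealth_succ, mul_add]
    rw [ih, (hsum n).tsum_add hb, ← tsum_mul_right]
    simp only [mul_assoc]

/-- Account `k` receives a share of `α` proportional to `v k` and is stopped at `T k`. After a hit
it contributes a multiple of `v k * T k` at all later times, so hits for arbitrarily large `k` give
a limit and not merely an unbounded capital. Prudence is needed only up to the hit and only on the
paths where `E` fails, because stopping protects the account on all others. -/
theorem canForce_of_hits {α : ℝ} (hα : 0 < α) {E : Path → Prop} (p : ℕ → Path → ℕ → ℝ)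
    (hp : ∀ k, Predictable (p k)) (v T : ℕ → ℝ) (hv : ∀ k, 0 < v k) (hs : Summable v)
    (hvT : Tendsto (fun k => v k * T k) atTop atTop)
    (h : ∀ ω, ¬ E ω → ∃ᶠ k in atTop, ∃ n, T k ≤ wealth 1 (p k) ω n ∧
      ∀ i < n, |p k ω i| * ω.c i ≤ wealth 1 (p k) ω i) :
    CanForce α E := by
  choose q hq1 hq2 hq3 using fun k => (hp k).exists_prudent_stopped (T k)
  have hV : 0 < ∑' k, v k := hs.tsum_pos (fun k => (hv k).le) 0 (hv 0)
  set a : ℕ → ℝ := fun k => α / (∑' k, v k) * v k with ha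
  have hc : 0 < α / (∑' k, v k) := div_pos hα hV
  have ha0 : ∀ k, 0 ≤ a k := fun k => (mul_pos hc (hv k)).le
  have hsa : Summable a := hs.mul_left _
  have hta : ∑' k, a k = α := by
    rw [ha, tsum_mul_left]; field_simp
  have hpred : Predictable (fun ω n => ∑' k, a k * q k ω n) := fun n ω ω' hag hcn =>
    tsum_congr fun k => by rw [hq1 k n ω ω' hag hcn]
  obtain ⟨P, hP⟩ := hpred.exists_strategy
  have hcap : ∀ ω n, P.capital α ω n = ∑' k, a k * wealth 1 (q k) ω n := by
    intro ω n
    rw [hP, ← (wealth_tsum hq2 ha0 hsa ω n).2, hta]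
  have hterm : ∀ ω n k, 0 ≤ a k * wealth 1 (q k) ω n := fun ω n k =>
    mul_nonneg (ha0 k) ((hq2 k).nonneg ω n)
  refine ⟨P, fun ω => ⟨fun n => by rw [hcap]; exact tsum_nonneg (hterm ω n), fun hE => ?_⟩⟩
  refine tendsto_atTop.2 fun B => ?_
  obtain ⟨k, ⟨n, hn, hpr⟩, hk⟩ :=
    ((h ω hE).and_eventually ((hvT.const_mul_atTop hc).eventually_ge_atTop B)).exists
  filter_upwards [eventually_ge_atTop n] with j hj
  rw [hcap]
  calc B ≤ a k * T k := by rw [ha]; simpa [mul_assoc] using hk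
    _ ≤ a k * wealth 1 (q k) ω j := mul_le_mul_of_nonneg_left (hq3 k ω n hn hpr j hj) (ha0 k)
    _ ≤ _ := (wealth_tsum hq2 ha0 hsa ω j).1.le_tsum k fun i _ => hterm ω j i

lemma CanForce.mono {α : ℝ} {E F : Path → Prop} (h : CanForce α E) (hEF : ∀ ω, E ω → F ω) :
    CanForce α F := by
  obtain ⟨P, hP⟩ := h
  exact ⟨P, fun ω => ⟨(hP ω).1, fun hF => (hP ω).2 fun hE => hF (hEF ω hE)⟩⟩

lemma CanForce.and {α : ℝ} {E F : Path → Prop} (hE : CanForce (α / 2) E)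
    (hF : CanForce (α / 2) F) : CanForce α (fun ω => E ω ∧ F ω) := by
  obtain ⟨P, hP⟩ := hE
  obtain ⟨Q, hQ⟩ := hF
  let R : Strategy := fun n h c => P n h c + Q n h c
  have hR : ∀ ω n, R.capital α ω n = P.capital (α / 2) ω n + Q.capital (α / 2) ω n := by
    intro ω n
    induction n with
    | zero => simp [Strategy.capital]
    | succ n ih =>
      simp only [Strategy.capital, ih]
      have : R.move ω n = P.move ω n + Q.move ω n := rfl
      rw [this]; ring
  refine ⟨R, fun ω => ⟨fun n => ?_, fun h => ?_⟩⟩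
  · rw [hR]; exact add_nonneg ((hP ω).1 n) ((hQ ω).1 n)
  · rw [funext (hR ω)]
    by_cases hE : E ω
    · exact tendsto_atTop_mono (fun n => by linarith [(hP ω).1 n])
        ((hQ ω).2 fun hF => h ⟨hE, hF⟩)
    · exact tendsto_atTop_mono (fun n => by linarith [(hQ ω).1 n]) ((hP ω).2 hE)

/-! ### Exponential capitals and their combinations -/

lemma abs_log_one_add_sub_le {y : ℝ} (hy : |y| ≤ 1 / 2) :
    |Real.log (1 + y) - (y - y ^ 2 / 2)| ≤ 2 * |y| ^ 3 := by
  have h := Real.abs_log_sub_add_sum_range_le (x := -y) (by rw [abs_neg]; linarith) 2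
  rw [abs_neg] at h
  simp only [Finset.sum_range_succ, Finset.sum_range_zero] at h
  norm_num at h
  have e : Real.log (1 + y) - (y - y ^ 2 / 2) = -y + y ^ 2 / 2 + Real.log (1 + y) := by ring
  rw [e]
  refine h.trans ?_
  rw [div_le_iff₀ (by linarith)]
  nlinarith [pow_nonneg (abs_nonneg y) 3]

lemma exp_le_one_add {y : ℝ} (hy : |y| ≤ 1 / 2) :
    Real.exp (y - y ^ 2 / 2 - 2 * |y| ^ 3) ≤ 1 + y := by
  have h0 : 0 < 1 + y := by linarith [(abs_le.1 hy).1]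
  rw [← Real.le_log_iff_exp_le h0]
  linarith [(abs_le.1 (abs_log_one_add_sub_le hy)).1]

lemma one_add_le_exp {y : ℝ} (hy : |y| ≤ 1 / 2) :
    1 + y ≤ Real.exp (y - y ^ 2 / 2 + 2 * |y| ^ 3) := by
  have h0 : 0 < 1 + y := by linarith [(abs_le.1 hy).1]
  rw [← Real.log_le_iff_le_exp h0]
  linarith [(abs_le.1 (abs_log_one_add_sub_le hy)).2]

open Classical in
/-- The fraction `γ` of the capital while `A²` lies in `[a, b)` and the bet is safe. -/
noncomputable def gate (γ a b : ℝ) (ω : Path) (i : ℕ) : ℝ :=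
  if a ≤ ω.Asq i ∧ ω.Asq i < b ∧ |γ| * ω.c i ≤ 1 / 2 then γ else 0

lemma gate_predictable (γ a b : ℝ) : Predictable (gate γ a b) := fun n ω ω' h hc => by
  simp only [gate, adapted_Asq n ω ω' h, hc]

lemma abs_gate_mul_c_le (γ a b : ℝ) (ω : Path) (i : ℕ) : |gate γ a b ω i| * ω.c i ≤ 1 / 2 := by
  unfold gate
  split_ifs with h
  · exact h.2.2
  · simp

lemma abs_gate_mul_x_le (γ a b : ℝ) (ω : Path) (i : ℕ) : |gate γ a b ω i * ω.x i| ≤ 1 / 2 :=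
  (abs_bet_le _ _ _).trans (abs_gate_mul_c_le γ a b ω i)

/-- The capital that starts from `1` and bets the fraction `gate γ a b` in each round. -/
noncomputable def expCap (γ a b : ℝ) (ω : Path) (n : ℕ) : ℝ :=
  ∏ i ∈ Finset.range n, (1 + gate γ a b ω i * ω.x i)

noncomputable def expBet (γ a b : ℝ) (ω : Path) (n : ℕ) : ℝ :=
  gate γ a b ω n * expCap γ a b ω n

lemma expCap_pos (γ a b : ℝ) (ω : Path) (n : ℕ) : 0 < expCap γ a b ω n :=
  Finset.prod_pos fun i _ => by linarith [(abs_le.1 (abs_gate_mul_x_le γ a b ω i)).1]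

lemma expCap_succ (γ a b : ℝ) (ω : Path) (n : ℕ) :
    expCap γ a b ω (n + 1) = expCap γ a b ω n + expBet γ a b ω n * ω.x n := by
  rw [expCap, Finset.prod_range_succ, expBet, ← expCap]; ring

lemma expCap_adapted (γ a b : ℝ) : Adapted (expCap γ a b) := fun n ω ω' h =>
  Finset.prod_congr rfl fun i hi => by
    have hi' := Finset.mem_range.1 hi
    rw [gate_predictable γ a b i ω ω' (h.mono hi'.le) (h i hi').1, (h i hi').2]

lemma expBet_predictable (γ a b : ℝ) : Predictable (expBet γ a b) := fun n ω ω' h hc => by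
  rw [expBet, expBet, gate_predictable γ a b n ω ω' h hc, expCap_adapted γ a b n ω ω' h]

lemma abs_expBet_mul_c_le (γ a b : ℝ) (ω : Path) (n : ℕ) :
    |expBet γ a b ω n| * ω.c n ≤ 1 / 2 * expCap γ a b ω n := by
  rw [expBet, abs_mul, abs_of_pos (expCap_pos γ a b ω n)]
  calc |gate γ a b ω n| * expCap γ a b ω n * ω.c n
      = |gate γ a b ω n| * ω.c n * expCap γ a b ω n := by ring
    _ ≤ _ := mul_le_mul_of_nonneg_right (abs_gate_mul_c_le γ a b ω n) (expCap_pos γ a b ω n).le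

/-- Finite linear combination of the bets `expBet`. -/
noncomputable def combBet {ι : Type*} (s : Finset ι) (θ γ a b : ι → ℝ) (ω : Path) (n : ℕ) : ℝ :=
  ∑ k ∈ s, θ k * expBet (γ k) (a k) (b k) ω n

lemma combBet_predictable {ι : Type*} (s : Finset ι) (θ γ a b : ι → ℝ) :
    Predictable (combBet s θ γ a b) := fun n ω ω' h hc =>
  Finset.sum_congr rfl fun k _ => by rw [expBet_predictable (γ k) (a k) (b k) n ω ω' h hc]

lemma wealth_combBet {ι : Type*} (s : Finset ι) (θ γ a b : ι → ℝ) (ω : Path) (n : ℕ) :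
    wealth 1 (combBet s θ γ a b) ω n =
      1 + ∑ k ∈ s, θ k * (expCap (γ k) (a k) (b k) ω n - 1) := by
  induction n with
  | zero => simp [wealth_zero, expCap]
  | succ n ih =>
    rw [wealth_succ, ih, combBet, Finset.sum_mul, add_assoc, ← Finset.sum_add_distrib]
    congr 1
    refine Finset.sum_congr rfl fun k _ => ?_
    rw [expCap_succ]; ring

lemma wealth_combBet_const {ι : Type*} (s : Finset ι) (hs : s.Nonempty) (γ a b : ι → ℝ)
    (ω : Path) (n : ℕ) :
    wealth 1 (combBet s (fun _ => (s.card : ℝ)⁻¹) γ a b) ω n =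
      (s.card : ℝ)⁻¹ * ∑ k ∈ s, expCap (γ k) (a k) (b k) ω n := by
  have : (s.card : ℝ) ≠ 0 := by exact_mod_cast hs.card_pos.ne'
  rw [wealth_combBet, ← Finset.mul_sum, Finset.sum_sub_distrib]
  simp
  field_simp
  ring

lemma abs_combBet_mul_c_le {ι : Type*} (s : Finset ι) (θ γ a b : ι → ℝ) (ω : Path) (n : ℕ) :
    |combBet s θ γ a b ω n| * ω.c n ≤
      ∑ k ∈ s, |θ k| * (|expBet (γ k) (a k) (b k) ω n| * ω.c n) := by
  rw [combBet]
  calc _ ≤ (∑ k ∈ s, |θ k * expBet (γ k) (a k) (b k) ω n|) * ω.c n :=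
        mul_le_mul_of_nonneg_right (Finset.abs_sum_le_sum_abs _ _) (ω.c_nonneg n)
    _ = _ := by
        rw [Finset.sum_mul]
        exact Finset.sum_congr rfl fun k _ => by rw [abs_mul]; ring

/-- The average of finitely many exponential capitals is a prudent capital. -/
lemma combBet_const_prudent {ι : Type*} (s : Finset ι) (hs : s.Nonempty) (γ a b : ι → ℝ) :
    Prudent 1 (combBet s (fun _ => (s.card : ℝ)⁻¹) γ a b) := fun ω n => by
  rw [wealth_combBet_const s hs, Finset.mul_sum]
  refine (abs_combBet_mul_c_le _ _ _ _ _ _ _).trans (Finset.sum_le_sum fun k _ => ?_)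
  rw [abs_of_nonneg (by positivity)]
  refine mul_le_mul_of_nonneg_left ?_ (by positivity)
  linarith [abs_expBet_mul_c_le (γ k) (a k) (b k) ω n, expCap_pos (γ k) (a k) (b k) ω n]

lemma expCap_le_avg {ι : Type*} (s : Finset ι) (γ a b : ι → ℝ) {k : ι} (hk : k ∈ s)
    (ω : Path) (n : ℕ) :
    (s.card : ℝ)⁻¹ * expCap (γ k) (a k) (b k) ω n ≤
      wealth 1 (combBet s (fun _ => (s.card : ℝ)⁻¹) γ a b) ω n := by
  rw [wealth_combBet_const s ⟨k, hk⟩]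
  exact mul_le_mul_of_nonneg_left
    (Finset.single_le_sum (fun j _ => (expCap_pos (γ j) (a j) (b j) ω n).le) hk) (by positivity)

/-- Lower bound for the exponential capital while the bet is on from the start. -/
lemma exp_le_expCap {γ b : ℝ} {ω : Path} {n : ℕ} (hb : ∀ i < n, ω.Asq i < b)
    (hc : ∀ i < n, |γ| * ω.c i ≤ 1 / 2) :
    Real.exp (γ * ω.S n - γ ^ 2 * ω.Asq n / 2 -
      ∑ i ∈ Finset.range n, 2 * (|γ| * ω.c i) * (γ ^ 2 * ω.x i ^ 2)) ≤ expCap γ 0 b ω n := by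
  have e : γ * ω.S n - γ ^ 2 * ω.Asq n / 2 -
      ∑ i ∈ Finset.range n, 2 * (|γ| * ω.c i) * (γ ^ 2 * ω.x i ^ 2) =
      ∑ i ∈ Finset.range n, (γ * ω.x i - γ ^ 2 * ω.x i ^ 2 / 2 -
        2 * (|γ| * ω.c i) * (γ ^ 2 * ω.x i ^ 2)) := by
    rw [Path.S, Path.Asq, Finset.sum_sub_distrib, Finset.sum_sub_distrib, Finset.mul_sum,
      Finset.mul_sum, Finset.sum_div]
  rw [e, Real.exp_sum, expCap]
  refine Finset.prod_le_prod (fun _ _ => (Real.exp_pos _).le) fun i hi => ?_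
  have hi' := Finset.mem_range.1 hi
  have hg : gate γ 0 b ω i = γ := if_pos ⟨ω.Asq_nonneg i, hb i hi', hc i hi'⟩
  rw [hg]
  have hy : |γ * ω.x i| ≤ |γ| * ω.c i := by
    rw [abs_mul]; exact mul_le_mul_of_nonneg_left (ω.abs_x_le i) (abs_nonneg _)
  refine le_trans (Real.exp_le_exp.2 ?_) (exp_le_one_add (hy.trans (hc i hi')))
  -- The cubic error is charged to the quadratic term with the factor `|γ| c`, the quantity that
  -- regularity controls.
  have : |γ * ω.x i| ^ 3 ≤ (|γ| * ω.c i) * (γ ^ 2 * ω.x i ^ 2) := by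
    rw [pow_succ', sq_abs, mul_pow]
    exact mul_le_mul_of_nonneg_right hy (by positivity)
  rw [mul_pow]; nlinarith

/-- Upper bound for an exponential capital at time `n`: if the bet is on exactly in the rounds
`n₁ ≤ i < n₂` and the relative size of the bets is at most `η`. -/
lemma expCap_le_exp {γ a b η : ℝ} (hγ : 0 ≤ γ) {ω : Path} {n₁ n₂ n : ℕ} (h12 : n₁ ≤ n₂)
    (h2n : n₂ ≤ n) (h1 : ∀ i < n₁, ω.Asq i < a) (h2 : ∀ i, n₂ ≤ i → i < n → b ≤ ω.Asq i)
    (h3 : ∀ i, n₁ ≤ i → i < n₂ → a ≤ ω.Asq i ∧ ω.Asq i < b)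
    (hη : η ≤ 1 / 2) (hc : ∀ i, n₁ ≤ i → i < n₂ → γ * ω.c i ≤ η) :
    expCap γ a b ω n ≤ Real.exp (γ * (ω.S n₂ - ω.S n₁) -
      γ ^ 2 * (1 / 2 - 2 * η) * (ω.Asq n₂ - ω.Asq n₁)) := by
  have hS : ω.S n₂ - ω.S n₁ = ∑ i ∈ Finset.Ico n₁ n₂, ω.x i :=
    (Finset.sum_Ico_eq_sub _ h12).symm
  have hA : ω.Asq n₂ - ω.Asq n₁ = ∑ i ∈ Finset.Ico n₁ n₂, ω.x i ^ 2 :=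
    (Finset.sum_Ico_eq_sub _ h12).symm
  rw [hS, hA, Finset.mul_sum, Finset.mul_sum, ← Finset.sum_sub_distrib, Real.exp_sum]
  have hprod : expCap γ a b ω n = ∏ i ∈ Finset.Ico n₁ n₂, (1 + gate γ a b ω i * ω.x i) := by
    rw [expCap]
    symm
    refine Finset.prod_subset (fun i hi => ?_) fun i hi hi2 => ?_
    · rw [Finset.mem_Ico] at hi; rw [Finset.mem_range]; omega
    · rw [Finset.mem_range] at hi
      rw [Finset.mem_Ico] at hi2
      have : gate γ a b ω i = 0 := by
        refine if_neg ?_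
        rintro ⟨ha, hb, -⟩
        by_cases hi1 : i < n₁
        · exact (h1 i hi1).not_ge ha
        · exact (h2 i (by omega) hi).not_gt hb
      rw [this]; simp
  rw [hprod]
  refine Finset.prod_le_prod (fun i _ => ?_) fun i hi => ?_
  · linarith [(abs_le.1 (abs_gate_mul_x_le γ a b ω i)).1]
  · rw [Finset.mem_Ico] at hi
    have hci := hc i hi.1 hi.2
    have hg : gate γ a b ω i = γ := by
      refine if_pos ⟨(h3 i hi.1 hi.2).1, (h3 i hi.1 hi.2).2, ?_⟩
      rw [abs_of_nonneg hγ]; linarith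
    rw [hg]
    have hy : |γ * ω.x i| ≤ η := by
      rw [abs_mul, abs_of_nonneg hγ]
      exact (mul_le_mul_of_nonneg_left (ω.abs_x_le i) hγ).trans hci
    refine (one_add_le_exp (hy.trans hη)).trans (Real.exp_le_exp.2 ?_)
    have : |γ * ω.x i| ^ 3 ≤ η * (γ ^ 2 * ω.x i ^ 2) := by
      rw [pow_succ', sq_abs, mul_pow]
      exact mul_le_mul_of_nonneg_right hy (by positivity)
    rw [mul_pow]; nlinarith

/-! ### Consequences of regularity -/

lemma Path.A_sq (ω : Path) (n : ℕ) : ω.A n ^ 2 = ω.Asq n := Real.sq_sqrt (ω.Asq_nonneg n)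

/-- On a regular path Forecaster's moves are small in comparison with the past of the path. -/
lemma Regular.exists_bound {ψ : ℝ → ℝ} (hmono : MonotoneOn ψ (Set.Ici 1))
    (hψ : Tendsto ψ atTop atTop) {ω : Path} (h : Regular ψ ω) :
    ∃ C > 0, ∀ᶠ i in atTop, ω.c i * ψ (ω.Asq i) ^ 3 ≤ C * √(ω.Asq i) := by
  obtain ⟨hA, hlim⟩ := h
  obtain ⟨C₁, hC₁, -⟩ := EReal.lt_iff_exists_real_btwn.1 hlim
  have hev := eventually_lt_of_limsup_lt hC₁
  set C := max C₁ 1 with hC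
  have hC0 : 0 < C := lt_max_of_lt_right one_pos
  have hψA := hψ.comp hA
  refine ⟨2 * C, by positivity, ?_⟩
  filter_upwards [hev, hA.eventually_ge_atTop 1, hψA.eventually_ge_atTop (max 1 (2 * C))]
    with i h1 h2 h3
  have h1' : ω.c i * (ψ (ω.Asq (i + 1)) ^ 3 / ω.A (i + 1)) ≤ C :=
    (EReal.coe_lt_coe_iff.1 h1).le.trans (le_max_left _ _)
  have hle : ω.Asq i ≤ ω.Asq (i + 1) := ω.Asq_mono i.le_succ
  have hApos : 0 < ω.A (i + 1) := Real.sqrt_pos.2 (by linarith)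
  have hψle : ψ (ω.Asq i) ≤ ψ (ω.Asq (i + 1)) := hmono h2 (h2.trans hle) hle
  have h3' : max 1 (2 * C) ≤ ψ (ω.Asq i) := h3
  have hψ1 : 1 ≤ ψ (ω.Asq i) := (le_max_left _ _).trans h3'
  have hψ2 : 2 * C ≤ ψ (ω.Asq i) := (le_max_right _ _).trans h3'
  have hc := ω.c_nonneg i
  have hb : ω.c i * ψ (ω.Asq (i + 1)) ^ 3 ≤ C * ω.A (i + 1) := by
    rwa [← mul_div_assoc, div_le_iff₀ hApos] at h1'
  have hb2 : ω.c i * ψ (ω.Asq i) ^ 3 ≤ C * ω.A (i + 1) :=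
    le_trans (mul_le_mul_of_nonneg_left (pow_le_pow_left₀ (by linarith) hψle 3) hc) hb
  -- Since `ψ³ ≥ ψ ≥ 2 C`, a single move is at most half of `A (i + 1)`. Hence `A` at most doubles
  -- in one round, and `A (i + 1)` can be replaced by its predictable predecessor.
  have hcA : 2 * ω.c i ≤ ω.A (i + 1) := by
    have h4 : ψ (ω.Asq i) ≤ ψ (ω.Asq i) ^ 3 := le_self_pow₀ hψ1 (by norm_num)
    have h5 : ω.c i * (2 * C) ≤ C * ω.A (i + 1) :=
      le_trans (mul_le_mul_of_nonneg_left (hψ2.trans h4) hc) hb2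
    nlinarith
  have hA2 : ω.A (i + 1) ≤ 2 * √(ω.Asq i) := by
    have e1 := ω.A_sq (i + 1)
    have e2 := Real.sq_sqrt (ω.Asq_nonneg i)
    have e3 := ω.Asq_succ i
    have e4 := ω.sq_x_le i
    refine abs_le_of_sq_le_sq' ?_ (by positivity) |>.2
    nlinarith
  nlinarith

/-- The last bound follows from `ψ³ ≥ 8 C`; it limits the overshoot of `A²` over a threshold. -/
lemma Regular.exists_bounds {ψ : ℝ → ℝ} (hmono : MonotoneOn ψ (Set.Ici 1))
    (hψ : Tendsto ψ atTop atTop) {ω : Path} (h : Regular ψ ω) :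
    ∃ C > 0, ∃ n₀, ∀ i, n₀ ≤ i → 1 ≤ ω.Asq i ∧ ω.c i * ψ (ω.Asq i) ^ 3 ≤ C * √(ω.Asq i) ∧
      ω.c i ≤ √(ω.Asq i) / 8 := by
  obtain ⟨C, hC, hev⟩ := h.exists_bound hmono hψ
  refine ⟨C, hC, eventually_atTop.1 ?_⟩
  filter_upwards [hev, h.1.eventually_ge_atTop 1,
    (hψ.comp h.1).eventually_ge_atTop (max 1 (8 * C))] with i h0 h1 h2
  have h2' : max 1 (8 * C) ≤ ψ (ω.Asq i) := h2
  have h3 : 1 ≤ ψ (ω.Asq i) := (le_max_left _ _).trans h2'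
  have h4 : 8 * C ≤ ψ (ω.Asq i) ^ 3 :=
    ((le_max_right _ _).trans h2').trans (le_self_pow₀ h3 (by norm_num))
  have h6 := mul_le_mul_of_nonneg_left h4 (ω.c_nonneg i)
  have h7 : C * (ω.c i * 8) ≤ C * √(ω.Asq i) := by linarith
  exact ⟨h1, h0, by linarith [le_of_mul_le_mul_left h7 hC]⟩

/-! ### Levels of `ψ²` -/

/-- The first point at which `ψ ^ 2` reaches the level `m`. -/
noncomputable def thr (ψ : ℝ → ℝ) (m : ℕ) : ℝ := sInf {t | 1 ≤ t ∧ (m : ℝ) ≤ ψ t ^ 2}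

section Threshold

variable {ψ : ℝ → ℝ}

lemma thr_set_bddBelow (m : ℕ) : BddBelow {t : ℝ | 1 ≤ t ∧ (m : ℝ) ≤ ψ t ^ 2} :=
  ⟨1, fun _ h => h.1⟩

lemma thr_set_nonempty (hψ : Tendsto ψ atTop atTop) (m : ℕ) :
    {t : ℝ | 1 ≤ t ∧ (m : ℝ) ≤ ψ t ^ 2}.Nonempty := by
  obtain ⟨t, h1, h2⟩ := ((eventually_ge_atTop (1 : ℝ)).and
    (hψ.eventually_ge_atTop (m + 1 : ℝ))).exists
  exact ⟨t, h1, by nlinarith [(Nat.cast_nonneg m : (0 : ℝ) ≤ m)]⟩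

lemma one_le_thr (hψ : Tendsto ψ atTop atTop) (m : ℕ) : 1 ≤ thr ψ m :=
  le_csInf (thr_set_nonempty hψ m) fun _ h => h.1

lemma thr_mono (hψ : Tendsto ψ atTop atTop) : Monotone (thr ψ) := fun m n hmn =>
  csInf_le_csInf (thr_set_bddBelow m) (thr_set_nonempty hψ n) fun _ h =>
    ⟨h.1, le_trans (by exact_mod_cast hmn) h.2⟩

lemma thr_zero : thr ψ 0 = 1 := by
  have : {t : ℝ | 1 ≤ t ∧ ((0 : ℕ) : ℝ) ≤ ψ t ^ 2} = Set.Ici 1 := by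
    ext t; simp [sq_nonneg]
  rw [thr, this, csInf_Ici]

lemma sq_lt_of_lt_thr {m : ℕ} {t : ℝ} (h1 : 1 ≤ t) (h : t < thr ψ m) : ψ t ^ 2 < m := by
  by_contra! hc
  exact (csInf_le (thr_set_bddBelow m) ⟨h1, hc⟩).not_gt h

/-- Continuity makes the defining set closed, so its infimum belongs to it; monotonicity carries the
bound to the right. -/
lemma le_sq_of_thr_le (hcont : ContinuousOn ψ (Set.Ici 1)) (hmono : MonotoneOn ψ (Set.Ici 1))
    (hpos : ∀ t ∈ Set.Ici (1 : ℝ), 0 < ψ t) (hψ : Tendsto ψ atTop atTop) {m : ℕ} {t : ℝ}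
    (h : thr ψ m ≤ t) : (m : ℝ) ≤ ψ t ^ 2 := by
  have hcl : IsClosed {t : ℝ | 1 ≤ t ∧ (m : ℝ) ≤ ψ t ^ 2} :=
    (hcont.pow 2).preimage_isClosed_of_isClosed isClosed_Ici (isClosed_Ici (a := (m : ℝ)))
  have hmem : 1 ≤ thr ψ m ∧ (m : ℝ) ≤ ψ (thr ψ m) ^ 2 :=
    hcl.csInf_mem (thr_set_nonempty hψ m) (thr_set_bddBelow m)
  exact hmem.2.trans (pow_le_pow_left₀ (hpos _ hmem.1).le
    (hmono hmem.1 (hmem.1.trans h) h) 2)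

lemma tendsto_thr (hcont : ContinuousOn ψ (Set.Ici 1)) (hmono : MonotoneOn ψ (Set.Ici 1))
    (hpos : ∀ t ∈ Set.Ici (1 : ℝ), 0 < ψ t) (hψ : Tendsto ψ atTop atTop) :
    Tendsto (thr ψ) atTop atTop := by
  refine tendsto_atTop_atTop_of_monotone (thr_mono hψ) fun B => ?_
  obtain ⟨m, hm⟩ := exists_nat_gt (ψ B ^ 2)
  refine ⟨m, ?_⟩
  by_contra! hc
  exact (le_sq_of_thr_le hcont hmono hpos hψ hc.le).not_gt hm

end Threshold

/-! ### The integral as a series over levels -/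

lemma lintegral_const_div {a b κ : ℝ} (ha : 0 < a) (hab : a ≤ b) (hκ : 0 ≤ κ) :
    ∫⁻ t in Set.Ico a b, ENNReal.ofReal (κ / t) =
      ENNReal.ofReal (κ * (Real.log b - Real.log a)) := by
  have hb : 0 < b := ha.trans_le hab
  have hint : IntegrableOn (fun t : ℝ => κ / t) (Set.Ioc a b) := by
    refine (ContinuousOn.integrableOn_Icc ?_).mono_set Set.Ioc_subset_Icc_self
    exact continuousOn_const.div continuousOn_id fun t ht => (ha.trans_le ht.1).ne'
  rw [setLIntegral_congr (Ico_ae_eq_Ioc (μ := volume)), ← ofReal_integral_eq_lintegral_ofReal hint,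
    ← intervalIntegral.integral_of_le hab]
  · congr 1
    simp_rw [div_eq_mul_one_div κ]
    rw [intervalIntegral.integral_const_mul, integral_one_div_of_pos ha hb,
      Real.log_div hb.ne' ha.ne']
  · refine (ae_restrict_iff' measurableSet_Ioc).2 (Eventually.of_forall fun t ht => ?_)
    exact div_nonneg hκ (ha.trans ht.1).le

section Integral

variable {ψ : ℝ → ℝ}

lemma ofReal_le_setLIntegral {a b κ : ℝ} (ha : 0 < a) (hab : a ≤ b) (hκ : 0 ≤ κ)
    (h : ∀ t ∈ Set.Ico a b, κ ≤ ψ t * Real.exp (-(ψ t) ^ 2 / 2)) :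
    ENNReal.ofReal (κ * (Real.log b - Real.log a)) ≤
      ∫⁻ t in Set.Ico a b, ENNReal.ofReal (ψ t * Real.exp (-(ψ t) ^ 2 / 2) / t) := by
  rw [← lintegral_const_div ha hab hκ]
  exact setLIntegral_mono' measurableSet_Ico fun t ht => ENNReal.ofReal_le_ofReal
    (div_le_div_of_nonneg_right (h t ht) (ha.trans_le ht.1).le)

lemma setLIntegral_le_ofReal {a b κ : ℝ} (ha : 0 < a) (hab : a ≤ b) (hκ : 0 ≤ κ)
    (h : ∀ t ∈ Set.Ico a b, ψ t * Real.exp (-(ψ t) ^ 2 / 2) ≤ κ) :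
    ∫⁻ t in Set.Ico a b, ENNReal.ofReal (ψ t * Real.exp (-(ψ t) ^ 2 / 2) / t) ≤
      ENNReal.ofReal (κ * (Real.log b - Real.log a)) := by
  rw [← lintegral_const_div ha hab hκ]
  exact setLIntegral_mono' measurableSet_Ico fun t ht => ENNReal.ofReal_le_ofReal
    (div_le_div_of_nonneg_right (h t ht) (ha.trans_le ht.1).le)

/-- If `ψ` were bounded, the integrand would dominate a positive multiple of `1 / t`. -/
lemma tendsto_of_integralI_lt_top (hmono : MonotoneOn ψ (Set.Ici 1))
    (hpos : ∀ t ∈ Set.Ici (1 : ℝ), 0 < ψ t) (hI : integralI ψ < ⊤) :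
    Tendsto ψ atTop atTop := by
  by_cases hub : ∀ B, ∃ t ∈ Set.Ici (1 : ℝ), B ≤ ψ t
  · refine tendsto_atTop.2 fun B => ?_
    obtain ⟨t, ht, hB⟩ := hub B
    filter_upwards [eventually_ge_atTop t] with r hr
    exact hB.trans (hmono ht (le_trans ht hr) hr)
  · exfalso
    push Not at hub
    obtain ⟨B, hB⟩ := hub
    have h1 := hpos 1 (Set.mem_Ici.2 le_rfl)
    set κ := ψ 1 * Real.exp (-B ^ 2 / 2) with hκ
    have hκ0 : 0 < κ := mul_pos h1 (Real.exp_pos _)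
    set R := (integralI ψ).toReal with hR
    have hR0 : 0 ≤ R := ENNReal.toReal_nonneg
    -- The right endpoint makes the lower bound `R + 1`, one more than the whole integral.
    have hle := ofReal_le_setLIntegral (ψ := ψ) (a := 1) (b := Real.exp ((R + 1) / κ)) one_pos
      (Real.one_le_exp (by positivity)) hκ0.le (fun t ht => by
        have h2 := hmono (Set.mem_Ici.2 le_rfl) ht.1 ht.1
        have h3 := hB t ht.1
        refine mul_le_mul h2 (Real.exp_le_exp.2 ?_) (Real.exp_pos _).le (h1.le.trans h2)
        nlinarith [h1.le.trans h2])
    have hle2 := hle.trans (lintegral_mono_set (Set.Ico_subset_Ici_self))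
    rw [Real.log_exp, Real.log_one, sub_zero, mul_div_cancel₀ _ hκ0.ne'] at hle2
    have : R + 1 ≤ R := (ENNReal.ofReal_le_iff_le_toReal hI.ne).1 hle2
    linarith

/-- The logarithmic length of the interval on which `ψ ^ 2` lies in `[m, m + 1)`. -/
noncomputable def lev (ψ : ℝ → ℝ) (m : ℕ) : ℝ :=
  Real.log (thr ψ (m + 1)) - Real.log (thr ψ m)

lemma lev_nonneg (hψ : Tendsto ψ atTop atTop) (m : ℕ) : 0 ≤ lev ψ m :=
  sub_nonneg.2 (Real.log_le_log (one_pos.trans_le (one_le_thr hψ m)) (thr_mono hψ m.le_succ))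

lemma integralI_eq_tsum (hcont : ContinuousOn ψ (Set.Ici 1)) (hmono : MonotoneOn ψ (Set.Ici 1))
    (hpos : ∀ t ∈ Set.Ici (1 : ℝ), 0 < ψ t) (hψ : Tendsto ψ atTop atTop) :
    integralI ψ = ∑' m, ∫⁻ t in Set.Ico (thr ψ m) (thr ψ (m + 1)),
      ENNReal.ofReal (ψ t * Real.exp (-(ψ t) ^ 2 / 2) / t) := by
  have hU : ⋃ m, Set.Ico (thr ψ m) (thr ψ (m + 1)) = Set.Ici 1 := by
    rw [← thr_zero (ψ := ψ)]
    refine Set.Subset.antisymm (Set.iUnion_subset fun m t ht => (thr_mono hψ m.zero_le).trans ht.1)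
      fun t ht => ?_
    have hex : ∃ m, t < thr ψ m :=
      ((tendsto_thr hcont hmono hpos hψ).eventually_gt_atTop t).exists
    have h0 : Nat.find hex ≠ 0 := fun h => by
      have := Nat.find_spec hex
      rw [h] at this
      exact this.not_ge ht
    refine Set.mem_iUnion.2 ⟨Nat.find hex - 1, not_lt.1 (Nat.find_min hex (by omega)), ?_⟩
    rw [Nat.sub_add_cancel (by omega)]
    exact Nat.find_spec hex
  rw [integralI, ← hU]
  exact lintegral_iUnion (fun m => measurableSet_Ico)
    (by simpa [Nat.succ_eq_succ] using (thr_mono hψ).pairwise_disjoint_on_Ico_succ) _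

lemma mem_level (hcont : ContinuousOn ψ (Set.Ici 1)) (hmono : MonotoneOn ψ (Set.Ici 1))
    (hpos : ∀ t ∈ Set.Ici (1 : ℝ), 0 < ψ t) (hψ : Tendsto ψ atTop atTop) {m : ℕ} {t : ℝ}
    (ht : t ∈ Set.Ico (thr ψ m) (thr ψ (m + 1))) :
    0 < ψ t ∧ (m : ℝ) ≤ ψ t ^ 2 ∧ ψ t ^ 2 ≤ m + 1 :=
  ⟨hpos t ((one_le_thr hψ m).trans ht.1), le_sq_of_thr_le hcont hmono hpos hψ ht.1,
    by exact_mod_cast (sq_lt_of_lt_thr ((one_le_thr hψ m).trans ht.1) ht.2).le⟩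

/-- On level `m` one has `ψ ≥ √m` and `exp (-ψ² / 2) ≥ exp (-(m + 1) / 2)`; the shift from `m` to `m
+ 1` costs the factor `exp (1 / 2)`. -/
lemma summable_of_integralI_lt_top (hcont : ContinuousOn ψ (Set.Ici 1))
    (hmono : MonotoneOn ψ (Set.Ici 1)) (hpos : ∀ t ∈ Set.Ici (1 : ℝ), 0 < ψ t)
    (hI : integralI ψ < ⊤) :
    Summable fun m : ℕ => lev ψ m * (√m * Real.exp (-m / 2)) := by
  have hψ := tendsto_of_integralI_lt_top hmono hpos hI
  have hle : ∑' m : ℕ, ENNReal.ofReal (√m * Real.exp (-(m + 1) / 2) * lev ψ m) ≤ integralI ψ := by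
    rw [integralI_eq_tsum hcont hmono hpos hψ]
    refine ENNReal.tsum_le_tsum fun m => ?_
    refine ofReal_le_setLIntegral (one_pos.trans_le (one_le_thr hψ m)) (thr_mono hψ m.le_succ)
      (by positivity) fun t ht => ?_
    obtain ⟨h0, h1, h2⟩ := mem_level hcont hmono hpos hψ ht
    refine mul_le_mul (Real.sqrt_le_iff.2 ⟨h0.le, h1⟩) (Real.exp_le_exp.2 ?_)
      (Real.exp_pos _).le h0.le
    linarith
  have hs := ENNReal.summable_toReal (hle.trans_lt hI).ne
  refine (hs.mul_left (Real.exp (1 / 2))).congr fun m => ?_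
  rw [ENNReal.toReal_ofReal (mul_nonneg (by positivity) (lev_nonneg hψ m))]
  have : Real.exp (-(m : ℝ) / 2) = Real.exp (1 / 2) * Real.exp (-(m + 1) / 2) := by
    rw [← Real.exp_add]; congr 1; ring
  rw [this]; ring

lemma not_summable_of_integralI_eq_top (hcont : ContinuousOn ψ (Set.Ici 1))
    (hmono : MonotoneOn ψ (Set.Ici 1)) (hpos : ∀ t ∈ Set.Ici (1 : ℝ), 0 < ψ t)
    (hψ : Tendsto ψ atTop atTop) (hI : integralI ψ = ⊤) :
    ¬ Summable fun m : ℕ => √(m + 1) * Real.exp (-m / 2) * lev ψ m := by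
  intro hs
  have hle : integralI ψ ≤
      ∑' m : ℕ, ENNReal.ofReal (√(m + 1) * Real.exp (-m / 2) * lev ψ m) := by
    rw [integralI_eq_tsum hcont hmono hpos hψ]
    refine ENNReal.tsum_le_tsum fun m => ?_
    refine setLIntegral_le_ofReal (one_pos.trans_le (one_le_thr hψ m)) (thr_mono hψ m.le_succ)
      (by positivity) fun t ht => ?_
    obtain ⟨h0, h1, h2⟩ := mem_level hcont hmono hpos hψ ht
    refine mul_le_mul (Real.le_sqrt_of_sq_le h2) (Real.exp_le_exp.2 ?_)
      (Real.exp_pos _).le (by positivity)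
    linarith
  rw [← ENNReal.ofReal_tsum_of_nonneg (fun m => mul_nonneg (by positivity) (lev_nonneg hψ m)) hs,
    hI, top_le_iff] at hle
  exact ENNReal.ofReal_ne_top hle

end Integral

/-! ### Auxiliary series and sums -/

lemma exists_tendsto_summable_mul {w : ℕ → ℝ} (hw : ∀ k, 0 < w k) (hs : Summable w) :
    ∃ h : ℕ → ℝ, (∀ k, 0 < h k) ∧ Tendsto h atTop atTop ∧ Summable fun k => h k * w k := by
  set t : ℕ → ℝ := fun k => ∑' j, w (j + k) with ht
  have hsk : ∀ k, Summable fun j => w (j + k) := fun k => (summable_nat_add_iff k).2 hs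
  have ht0 : ∀ k, 0 < t k := fun k => (hsk k).tsum_pos (fun j => (hw _).le) 0 (hw _)
  have hstep : ∀ k, t k = w k + t (k + 1) := by
    intro k
    rw [ht]
    simp only
    rw [(hsk k).tsum_eq_zero_add, zero_add]
    congr 1
    exact tsum_congr fun j => by congr 1; ring
  have hlim : Tendsto t atTop (𝓝 0) := tendsto_sum_nat_add w
  -- With the tails `t`, the choice `h = 1 / √t` works because `w k / √(t k) ≤ 2 (√(t k) - √(t (k +
  -- 1)))` telescopes.
  refine ⟨fun k => (√(t k))⁻¹, fun k => inv_pos.2 (Real.sqrt_pos.2 (ht0 k)), ?_, ?_⟩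
  · refine Tendsto.inv_tendsto_nhdsGT_zero (tendsto_nhdsWithin_iff.2 ⟨?_, ?_⟩)
    · simpa [Function.comp_def] using (Real.continuous_sqrt.tendsto 0).comp hlim
    · exact Eventually.of_forall fun k => Real.sqrt_pos.2 (ht0 k)
  · refine summable_of_sum_range_le (c := 2 * √(t 0))
      (fun k => mul_nonneg (inv_nonneg.2 (Real.sqrt_nonneg _)) (hw k).le) fun n => ?_
    have : ∑ k ∈ Finset.range n, (√(t k))⁻¹ * w k ≤ 2 * √(t 0) - 2 * √(t n) := by
      induction n with
      | zero => simp
      | succ n ih =>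
        rw [Finset.sum_range_succ]
        have h1 := Real.sqrt_pos.2 (ht0 n)
        have h2 := Real.sqrt_nonneg (t (n + 1))
        have e1 := Real.sq_sqrt (ht0 n).le
        have e2 := Real.sq_sqrt (ht0 (n + 1)).le
        have : (√(t n))⁻¹ * w n ≤ 2 * √(t n) - 2 * √(t (n + 1)) := by
          rw [inv_mul_le_iff₀ h1]
          nlinarith [hstep n, sq_nonneg (√(t n) - √(t (n + 1)))]
        linarith
    linarith [Real.sqrt_nonneg (t n)]

lemma sqrt_nat_le_exp (m : ℕ) : √(m : ℝ) ≤ 2 * Real.exp (m / 8) := by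
  rw [Real.sqrt_le_iff]
  refine ⟨by positivity, ?_⟩
  have h : (2 * Real.exp ((m : ℝ) / 8)) ^ 2 = 4 * Real.exp (m / 4) := by
    rw [mul_pow, ← Real.exp_nat_mul]; norm_num; ring_nf
  rw [h]
  linarith [Real.add_one_le_exp ((m : ℝ) / 4)]

lemma summable_exp_neg_nat_div {c : ℝ} (hc : 0 < c) :
    Summable fun m : ℕ => Real.exp (-(m : ℝ) / c) := by
  refine ((Real.summable_exp_nat_mul_iff (a := -(1 / c))).2 (by simpa using hc)).congr fun m => ?_
  congr 1; ring

/-- The squares of the moves that are made while `A² ≤ B`. -/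
lemma Path.sum_ite_sq_le {ω : Path} {B : ℝ} (h : ∀ i, ω.Asq i ≤ B → ω.x i ^ 2 ≤ B) (n : ℕ)
    (hB : 0 ≤ B) :
    ∑ i ∈ Finset.range n, (if ω.Asq i ≤ B then ω.x i ^ 2 else 0) ≤ min (ω.Asq n) (2 * B) := by
  -- Both bounds are carried along: when the indicator is on, the first gives at most `B` so far,
  -- and the new square adds at most `B`.
  induction n with
  | zero => simp [Path.Asq, hB]
  | succ n ih =>
    have h1 := le_min_iff.1 ih
    rw [Finset.sum_range_succ, ω.Asq_succ]
    have h2 := sq_nonneg (ω.x n)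
    split_ifs with hn
    · exact le_min (by linarith [h1.1]) (by linarith [h1.1, h n hn])
    · exact le_min (by linarith [h1.1]) (by linarith [h1.2])

/-! ### Capped levels -/

section Capped

variable {ψ : ℝ → ℝ}

/-- The thresholds of the minimum of `ψ` and a multiple of the square root of `log log`. -/
noncomputable def cthr (ψ : ℝ → ℝ) (m : ℕ) : ℝ := max (thr ψ m) (Real.exp (Real.exp (m / 4)))

noncomputable def clev (ψ : ℝ → ℝ) (m : ℕ) : ℝ :=
  Real.log (cthr ψ (m + 1)) - Real.log (cthr ψ m)

lemma cthr_pos (ψ : ℝ → ℝ) (m : ℕ) : 0 < cthr ψ m := lt_max_of_lt_right (Real.exp_pos _)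

lemma log_cthr (hψ : Tendsto ψ atTop atTop) (m : ℕ) :
    Real.log (cthr ψ m) = max (Real.log (thr ψ m)) (Real.exp (m / 4)) := by
  have h0 : 0 < thr ψ m := one_pos.trans_le (one_le_thr hψ m)
  rw [cthr]
  rcases le_total (thr ψ m) (Real.exp (Real.exp (m / 4))) with h | h
  · rw [max_eq_right h, Real.log_exp, max_eq_right]
    rwa [Real.log_le_iff_le_exp h0]
  · rw [max_eq_left h, max_eq_left]
    rwa [Real.le_log_iff_exp_le h0]

lemma cthr_mono (hψ : Tendsto ψ atTop atTop) : Monotone (cthr ψ) := fun m n hmn =>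
  max_le_max (thr_mono hψ hmn) (Real.exp_le_exp.2 (Real.exp_le_exp.2 (by gcongr)))

lemma clev_nonneg (hψ : Tendsto ψ atTop atTop) (m : ℕ) : 0 ≤ clev ψ m :=
  sub_nonneg.2 (Real.log_le_log (cthr_pos ψ m) (cthr_mono hψ m.le_succ))

lemma clev_le (hψ : Tendsto ψ atTop atTop) (m : ℕ) :
    clev ψ m ≤ lev ψ m + Real.exp ((m + 1) / 4) := by
  have h1 := lev_nonneg hψ m
  rw [clev, log_cthr hψ, log_cthr hψ]
  rw [lev] at h1 ⊢
  push_cast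
  have h2 := le_max_left (Real.log (thr ψ m)) (Real.exp (m / 4))
  have h3 := le_max_right (Real.log (thr ψ m)) (Real.exp (m / 4))
  have h4 := Real.exp_pos ((m : ℝ) / 4)
  have h5 := Real.exp_pos (((m : ℝ) + 1) / 4)
  rcases max_cases (Real.log (thr ψ (m + 1))) (Real.exp (((m : ℝ) + 1) / 4)) with h | h <;>
    linarith [h.1]

lemma sq_div_le_cthr (m : ℕ) : (m : ℝ) ^ 2 / 32 ≤ cthr ψ m := by
  refine le_trans ?_ (le_max_right _ _)
  have h0 : (0 : ℝ) ≤ m := Nat.cast_nonneg m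
  have h1 := Real.add_one_le_exp ((m : ℝ) / 4)
  have h2 := Real.quadratic_le_exp_of_nonneg (Real.exp_pos ((m : ℝ) / 4)).le
  nlinarith

lemma eventually_mul_le_cthr (K : ℝ) : ∀ᶠ m : ℕ in atTop, K * m ≤ cthr ψ m := by
  filter_upwards [tendsto_natCast_atTop_atTop.eventually_ge_atTop (32 * K)] with m hm
  have h0 : (0 : ℝ) ≤ m := Nat.cast_nonneg m
  refine le_trans ?_ (sq_div_le_cthr m)
  nlinarith

lemma tendsto_cthr : Tendsto (cthr ψ) atTop atTop := by
  refine tendsto_atTop.2 fun B => ?_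
  filter_upwards [eventually_mul_le_cthr (ψ := ψ) (max B 0), eventually_ge_atTop 1] with m hm h1
  have : (1 : ℝ) ≤ m := by exact_mod_cast h1
  nlinarith [le_max_left B 0, le_max_right B 0]

/-- The cap lengthens a level by at most `exp ((m + 1) / 4)`, which the factor `exp (-m / 2)`
absorbs even after `√m` is replaced by a multiple of `exp (m / 8)`. -/
lemma summable_clev (hψ : Tendsto ψ atTop atTop)
    (hs : Summable fun m : ℕ => lev ψ m * (√m * Real.exp (-m / 2))) :
    Summable fun m : ℕ => clev ψ m * (√m * Real.exp (-m / 2)) := by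
  refine Summable.of_nonneg_of_le (fun m => mul_nonneg (clev_nonneg hψ m) (by positivity))
    (fun m => ?_) (hs.add ((summable_exp_neg_nat_div (c := 8) (by norm_num)).mul_left
      (2 * Real.exp (1 / 4))))
  refine (mul_le_mul_of_nonneg_right (clev_le hψ m) (by positivity)).trans ?_
  rw [add_mul]
  refine add_le_add le_rfl ?_
  calc Real.exp ((m + 1) / 4) * (√m * Real.exp (-m / 2))
      ≤ Real.exp ((m + 1) / 4) * (2 * Real.exp (m / 8) * Real.exp (-m / 2)) := by
        gcongr; exact sqrt_nat_le_exp m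
    _ = 2 * (Real.exp ((m + 1) / 4) * Real.exp (m / 8) * Real.exp (-m / 2)) := by ring
    _ = 2 * (Real.exp (1 / 4) * Real.exp (-m / 8)) := by
        rw [← Real.exp_add, ← Real.exp_add, ← Real.exp_add]; ring_nf
    _ = _ := by ring

lemma exists_log_thr_le (hψ : Tendsto ψ atTop atTop)
    (hs : Summable fun m : ℕ => lev ψ m * (√m * Real.exp (-m / 2))) :
    ∃ c, ∀ m : ℕ, Real.log (thr ψ m) ≤ c * Real.exp (m / 2) := by
  set T : ℕ → ℝ := fun m => lev ψ m * (√m * Real.exp (-m / 2)) with hT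
  have hT0 : ∀ m, 0 ≤ T m := fun m => mul_nonneg (lev_nonneg hψ m) (by positivity)
  have key : ∀ m : ℕ, Real.log (thr ψ (m + 1)) ≤
      (lev ψ 0 + ∑ j ∈ Finset.range (m + 1), T j) * Real.exp (((m + 1 : ℕ) : ℝ) / 2) := by
    intro m
    induction m with
    | zero =>
      have e : Real.log (thr ψ (0 + 1)) = lev ψ 0 := by simp [lev, thr_zero]
      -- The factor `√0` removes level `0` from the series, so `lev ψ 0` enters the constant
      -- separately.
      have h1 : T 0 = 0 := by simp [hT]
      rw [e, Finset.sum_range_one, h1, add_zero]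
      exact le_mul_of_one_le_right (lev_nonneg hψ 0) (Real.one_le_exp (by positivity))
    | succ m ih =>
      have e : Real.log (thr ψ (m + 1 + 1)) = Real.log (thr ψ (m + 1)) + lev ψ (m + 1) := by
        simp [lev]
      have h1 : lev ψ (m + 1) ≤ T (m + 1) * Real.exp (((m + 1 : ℕ) : ℝ) / 2) := by
        have : T (m + 1) * Real.exp (((m + 1 : ℕ) : ℝ) / 2) =
            lev ψ (m + 1) * √((m + 1 : ℕ) : ℝ) := by
          rw [hT]
          simp only
          rw [mul_assoc, mul_assoc, ← Real.exp_add]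
          have e0 : -((m + 1 : ℕ) : ℝ) / 2 + ((m + 1 : ℕ) : ℝ) / 2 = 0 := by ring
          rw [e0, Real.exp_zero, mul_one]
        rw [this]
        refine le_mul_of_one_le_right (lev_nonneg hψ _) (Real.one_le_sqrt.2 ?_)
        push_cast
        linarith [(Nat.cast_nonneg m : (0 : ℝ) ≤ m)]
      have h2 : 0 ≤ lev ψ 0 + ∑ j ∈ Finset.range (m + 1 + 1), T j :=
        add_nonneg (lev_nonneg hψ 0) (Finset.sum_nonneg fun j _ => hT0 j)
      have h3 : Real.exp (((m + 1 : ℕ) : ℝ) / 2) ≤ Real.exp (((m + 1 + 1 : ℕ) : ℝ) / 2) :=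
        Real.exp_le_exp.2 (by gcongr; simp)
      rw [e]
      refine le_trans ?_ (mul_le_mul_of_nonneg_left h3 h2)
      rw [Finset.sum_range_succ, ← add_assoc, add_mul]
      exact add_le_add ih h1
  refine ⟨lev ψ 0 + ∑' j, T j, fun m => ?_⟩
  have hc : 0 ≤ lev ψ 0 + ∑' j, T j := add_nonneg (lev_nonneg hψ 0) (tsum_nonneg hT0)
  rcases m with _ | m
  · simpa [thr_zero] using hc
  · refine (key m).trans (mul_le_mul_of_nonneg_right ?_ (Real.exp_pos _).le)
    gcongr
    exact hs.sum_le_tsum _ fun j _ => hT0 j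

/-- This is what the cap is for: if `A²` is within a factor `m` of the capped level `m`, then `ψ²`
is already at least `m / 3` (rounded down), and regularity makes the relative bets of order `1 / m`.
It holds because `log (thr ψ (m / 3))` is of order at most `exp (m / 6)`, against `exp (m / 4)` for
the cap. -/
lemma eventually_thr_mul_le_cthr (hψ : Tendsto ψ atTop atTop)
    (hs : Summable fun m : ℕ => lev ψ m * (√m * Real.exp (-m / 2))) :
    ∀ᶠ m : ℕ in atTop, thr ψ (m / 3) * m ≤ cthr ψ m := by
  obtain ⟨c, hc⟩ := exists_log_thr_le hψ hs
  have ht : Tendsto (fun m : ℕ => Real.exp ((m : ℝ) / 12)) atTop atTop :=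
    Real.tendsto_exp_atTop.comp
      (tendsto_natCast_atTop_atTop.atTop_div_const (by norm_num))
  filter_upwards [ht.eventually_ge_atTop (max c 0 + 6), eventually_ge_atTop 1] with m hm h1
  have hm0 : (0 : ℝ) < m := by exact_mod_cast h1
  have ht0 : 0 < thr ψ (m / 3) := one_pos.trans_le (one_le_thr hψ _)
  refine le_trans ?_ (le_max_right _ _)
  rw [← Real.log_le_iff_le_exp (mul_pos ht0 hm0), Real.log_mul ht0.ne' hm0.ne']
  have e : Real.exp ((m : ℝ) / 4) = Real.exp (m / 12) * Real.exp (m / 6) := by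
    rw [← Real.exp_add]; ring_nf
  have h2 : Real.log (thr ψ (m / 3)) ≤ max c 0 * Real.exp (m / 6) := by
    refine (hc _).trans (mul_le_mul (le_max_left _ _) (Real.exp_le_exp.2 ?_)
      (Real.exp_pos _).le (le_max_right _ _))
    have : ((m / 3 : ℕ) : ℝ) ≤ m / 3 := Nat.cast_div_le
    linarith
  have h3 : Real.log m ≤ 6 * Real.exp (m / 6) := by
    linarith [Real.log_le_sub_one_of_pos hm0, Real.add_one_le_exp ((m : ℝ) / 6)]
  have h4 := mul_le_mul_of_nonneg_right hm (Real.exp_pos ((m : ℝ) / 6)).le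
  rw [e]
  linarith

end Capped

/-! ### The convergence half -/

section Upper

variable {ψ : ℝ → ℝ}

/-- Number of grid points in the `m`-th capped level, minus one. -/
noncomputable def gridCard (ψ : ℝ → ℝ) (m : ℕ) : ℕ := ⌈clev ψ m * √m⌉₊

/-- The logarithmic step `1 / √m` is the coarsest, up to constants, for which a mismatch between
`A²` and the grid point costs only a constant in the exponent. -/
noncomputable def gridPt (ψ : ℝ → ℝ) (m j : ℕ) : ℝ := cthr ψ m * Real.exp (j / √m)

noncomputable def upperBet (ψ : ℝ → ℝ) (m : ℕ) : Path → ℕ → ℝ :=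
  combBet (Finset.range (gridCard ψ m + 1))
    (fun _ => ((Finset.range (gridCard ψ m + 1)).card : ℝ)⁻¹)
    (fun j => √m / √(gridPt ψ m j)) (fun _ => 0) (fun _ => cthr ψ (m + 1))

lemma exp_le_sq_one_add {y : ℝ} (h0 : 0 ≤ y) (h1 : y ≤ 1) : Real.exp y ≤ (1 + y) ^ 2 := by
  have h := (abs_le.1 (Real.abs_exp_sub_one_sub_id_le (abs_le.2 ⟨by linarith, h1⟩))).2
  nlinarith

lemma exists_grid {m : ℕ} (hm : 1 ≤ m) {l : ℝ}
    (h1 : cthr ψ m ≤ l) (h2 : l < cthr ψ (m + 1)) :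
    ∃ j ∈ Finset.range (gridCard ψ m + 1), cthr ψ m ≤ gridPt ψ m j ∧
      1 ≤ √l / √(gridPt ψ m j) ∧ √l / √(gridPt ψ m j) ≤ 1 + 1 / √m := by
  have hc := cthr_pos ψ m
  have hl : 0 < l := hc.trans_le h1
  have hD : 1 ≤ √(m : ℝ) := Real.one_le_sqrt.2 (by exact_mod_cast hm)
  have hD0 : 0 < √(m : ℝ) := by linarith
  set D := √(m : ℝ) with hDdef
  set y := (Real.log l - Real.log (cthr ψ m)) * D with hy
  have hy0 : 0 ≤ y := mul_nonneg (sub_nonneg.2 (Real.log_le_log hc h1)) hD0.le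
  have hyJ : y ≤ clev ψ m * D := by
    refine mul_le_mul_of_nonneg_right ?_ hD0.le
    rw [clev]
    linarith [Real.log_le_log hl h2.le]
  set j := ⌊y⌋₊ with hj
  have hj1 : (j : ℝ) ≤ y := Nat.floor_le hy0
  have hj2 : y < j + 1 := Nat.lt_floor_add_one y
  have hg : 0 < gridPt ψ m j := mul_pos hc (Real.exp_pos _)
  have hle : l = cthr ψ m * Real.exp (y / D) := by
    rw [hy, mul_div_cancel_right₀ _ hD0.ne', Real.exp_sub, Real.exp_log hl, Real.exp_log hc]
    field_simp
  have hratio : l / gridPt ψ m j = Real.exp ((y - j) / D) := by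
    rw [gridPt, hle, mul_div_mul_left _ _ hc.ne', ← Real.exp_sub, ← hDdef]
    ring_nf
  refine ⟨j, Finset.mem_range.2 ?_, ?_, ?_, ?_⟩
  · have : (j : ℝ) ≤ gridCard ψ m := hj1.trans (hyJ.trans (Nat.le_ceil _))
    have : j ≤ gridCard ψ m := by exact_mod_cast this
    omega
  · exact le_mul_of_one_le_right hc.le (Real.one_le_exp (by positivity))
  · rw [← Real.sqrt_div hl.le, hratio, Real.one_le_sqrt]
    exact Real.one_le_exp (div_nonneg (by linarith) hD0.le)
  · rw [← Real.sqrt_div hl.le, hratio]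
    refine Real.sqrt_le_iff.2 ⟨by positivity, ?_⟩
    refine le_trans (Real.exp_le_exp.2 ?_) (exp_le_sq_one_add (by positivity) ?_)
    · exact div_le_div_of_nonneg_right (by linarith) hD0.le
    · rw [div_le_one hD0]; exact hD

/-- With `D = √m` and `ρ = √l / √g` for the grid point `g` just below `l = A²`, the main exponent is
at least `D² ρ - D² ρ² / 2 = m / 2 - D² (ρ - 1)² / 2 ≥ m / 2 - 1 / 2`. The cubic errors add at most
`8 + 128 C`. The hypotheses on `m` make the finitely many rounds before `n₀` harmless. -/
lemma exp_le_expCap_of_le_S (hcont : ContinuousOn ψ (Set.Ici 1))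
    (hmono : MonotoneOn ψ (Set.Ici 1)) (hpos : ∀ t ∈ Set.Ici (1 : ℝ), 0 < ψ t)
    (hψ : Tendsto ψ atTop atTop) {ω : Path} {C : ℝ} (hC : 0 < C) {n₀ : ℕ}
    (hn₀ : ∀ i, n₀ ≤ i → 1 ≤ ω.Asq i ∧ ω.c i * ψ (ω.Asq i) ^ 3 ≤ C * √(ω.Asq i) ∧
      ω.c i ≤ √(ω.Asq i) / 8) {m : ℕ} (hm1 : 16 ≤ m) (hm2 : 64 * C ≤ m)
    (hm3 : thr ψ (m / 3) * m ≤ cthr ψ m)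
    (hm4 : (4 * (∑ i ∈ Finset.range n₀, ω.c i) ^ 2) * m ≤ cthr ψ m)
    (hm5 : (ω.Asq n₀) * m ≤ cthr ψ m) {n : ℕ} (h1 : cthr ψ m ≤ ω.Asq n)
    (h2 : ω.Asq n < cthr ψ (m + 1)) (hS : ω.A n * ψ (ω.Asq n) ≤ ω.S n) :
    ∃ j ∈ Finset.range (gridCard ψ m + 1),
      Real.exp ((m : ℝ) / 2 - (9 + 128 * C)) ≤
        expCap (√m / √(gridPt ψ m j)) 0 (cthr ψ (m + 1)) ω n := by
  obtain ⟨j, hj, hg, hρ1, hρ2⟩ := exists_grid (by omega) h1 h2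
  refine ⟨j, hj, ?_⟩
  have hc := cthr_pos ψ m
  set l := ω.Asq n with hl
  have hl0 : 0 < l := hc.trans_le h1
  set g := gridPt ψ m j with hgdef
  have hg0 : 0 < √g := Real.sqrt_pos.2 (hc.trans_le hg)
  have hm0 : (16 : ℝ) ≤ m := by exact_mod_cast hm1
  have hm00 : (0 : ℝ) < m := by linarith
  set D := √(m : ℝ) with hD
  have hDsq : D ^ 2 = m := Real.sq_sqrt hm00.le
  have hD1 : 1 ≤ D := Real.one_le_sqrt.2 (by linarith)
  have hD0 : 0 < D := by linarith
  set ρ := √l / √g with hρ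
  have hρ0 : 0 < ρ := by linarith
  have hρ3 : ρ ≤ 2 := hρ2.trans (by linarith [(div_le_one hD0).2 hD1])
  set γ := D / √g with hγ
  have hγ0 : 0 < γ := div_pos hD0 hg0
  have hγl : γ * √l = D * ρ := by rw [hγ, hρ]; ring
  have hγl2 : γ ^ 2 * l = D ^ 2 * ρ ^ 2 := by
    rw [← mul_pow, ← hγl, mul_pow, Real.sq_sqrt hl0.le]
  have hB0 : 0 < l / m := div_pos hl0 hm00
  have hcm : cthr ψ m / m ≤ l / m := div_le_div_of_nonneg_right h1 hm00.le
  -- the first rounds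
  have hsmall : ∀ i < n₀, γ * ω.c i ≤ 1 / 2 ∧ ω.c i ^ 2 ≤ l / m := by
    intro i hi
    have hle : ω.c i ≤ ∑ i ∈ Finset.range n₀, ω.c i :=
      Finset.single_le_sum (fun k _ => ω.c_nonneg k) (Finset.mem_range.2 hi)
    have h3 : 4 * ω.c i ^ 2 * m ≤ cthr ψ m := by
      refine le_trans ?_ hm4
      have := pow_le_pow_left₀ (ω.c_nonneg i) hle 2
      gcongr
    constructor
    · rw [hγ, div_mul_eq_mul_div, div_le_iff₀ hg0]
      have : D * ω.c i * 2 ≤ √g := by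
        refine Real.le_sqrt_of_sq_le (le_trans ?_ hg)
        rw [mul_pow, mul_pow, hDsq]; linarith
      linarith
    · rw [le_div_iff₀ hm00]
      linarith [mul_nonneg (sq_nonneg (ω.c i)) hm00.le]
  have hlate : ∀ i, n₀ ≤ i → ω.c i ≤ √(ω.Asq i) / 8 := fun i hi => (hn₀ i hi).2.2
  have hx : ∀ i, ω.Asq i ≤ l / m → ω.x i ^ 2 ≤ l / m := by
    intro i hi
    refine (ω.sq_x_le i).trans ?_
    rcases lt_or_ge i n₀ with h | h
    · exact (hsmall i h).2
    · have h3 := hlate i h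
      have h4 := Real.sq_sqrt (ω.Asq_nonneg i)
      have h5 := pow_le_pow_left₀ (ω.c_nonneg i) h3 2
      rw [div_pow, h4] at h5
      linarith [ω.Asq_nonneg i]
  -- the size of the bets
  have hη1 : ∀ i < n, ω.Asq i ≤ l / m → γ * ω.c i ≤ 1 / 2 := by
    intro i hi hA
    rcases lt_or_ge i n₀ with h | h
    · exact (hsmall i h).1
    · have h3 : √(ω.Asq i) ≤ √l :=
        Real.sqrt_le_sqrt (ω.Asq_mono hi.le)
      have h4 : √(ω.Asq i) * D ≤ √l := by
        refine Real.le_sqrt_of_sq_le ?_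
        rw [mul_pow, hDsq, Real.sq_sqrt (ω.Asq_nonneg i)]
        rwa [le_div_iff₀ hm00] at hA
      have h5 : γ * ω.c i ≤ D * (√(ω.Asq i) / 8) / √g := by
        rw [hγ, div_mul_eq_mul_div]
        exact div_le_div_of_nonneg_right
          (mul_le_mul_of_nonneg_left (hlate i h) hD0.le) hg0.le
      have h6 : D * (√(ω.Asq i) / 8) / √g ≤ ρ / 8 := by
        rw [hρ, div_div, mul_comm (√g) 8, ← div_div]
        refine div_le_div_of_nonneg_right ?_ hg0.le
        linarith
      linarith
  have hη2 : ∀ i < n, ¬ ω.Asq i ≤ l / m → γ * ω.c i ≤ 16 * C / m := by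
    intro i hi hA
    have hA' := not_le.1 hA
    have hin : n₀ ≤ i := by
      by_contra! h
      refine hA ((ω.Asq_mono h.le).trans (le_trans ?_ hcm))
      rwa [le_div_iff₀ hm00]
    obtain ⟨h3, h4, -⟩ := hn₀ i hin
    have h5 : thr ψ (m / 3) ≤ ω.Asq i := by
      refine le_trans ?_ (hcm.trans hA'.le)
      rwa [le_div_iff₀ hm00]
    have h6 := le_sq_of_thr_le hcont hmono hpos hψ h5
    have h7 : (m : ℝ) / 4 ≤ ((m / 3 : ℕ) : ℝ) := by
      have : m ≤ 4 * (m / 3) := by omega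
      have : (m : ℝ) ≤ 4 * ((m / 3 : ℕ) : ℝ) := by exact_mod_cast this
      linarith
    have hψi := hpos _ (Set.mem_Ici.2 h3)
    have h8 : D / 2 ≤ ψ (ω.Asq i) := by
      refine abs_le_of_sq_le_sq' ?_ hψi.le |>.2
      rw [div_pow, hDsq]; linarith
    have h9 : (D / 2) ^ 3 ≤ ψ (ω.Asq i) ^ 3 := pow_le_pow_left₀ (by positivity) h8 3
    have h10 : ω.c i * (D / 2) ^ 3 ≤ C * √l :=
      (mul_le_mul_of_nonneg_left h9 (ω.c_nonneg i)).trans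
        (h4.trans (mul_le_mul_of_nonneg_left (Real.sqrt_le_sqrt (ω.Asq_mono hi.le)) hC.le))
    have h11 : γ * ω.c i * m ≤ 8 * C * ρ := by
      have e1 : γ * ω.c i * m = ω.c i * (D / 2) ^ 3 * (8 / √g) := by
        rw [← hDsq, hγ]; ring
      have e2 : 8 * C * ρ = C * √l * (8 / √g) := by rw [hρ]; ring
      rw [e1, e2]
      exact mul_le_mul_of_nonneg_right h10 (by positivity)
    rw [le_div_iff₀ hm00]
    linarith [mul_le_mul_of_nonneg_left hρ3 (by positivity : 0 ≤ 8 * C)]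
  have hCm : 16 * C / m ≤ 1 / 2 := by
    rw [div_le_iff₀ hm00]; linarith
  have hη : ∀ i < n, |γ| * ω.c i ≤ 1 / 2 := by
    intro i hi
    rw [abs_of_pos hγ0]
    by_cases h : ω.Asq i ≤ l / m
    · exact hη1 i hi h
    · exact (hη2 i hi h).trans hCm
  refine le_trans (Real.exp_le_exp.2 ?_)
    (exp_le_expCap (fun i hi => (ω.Asq_mono hi.le).trans_lt h2) hη)
  -- Rounds with `A² ≤ l / m` have only `γ c ≤ 1 / 2`, but their squares sum to at most `2 l / m`
  -- and cost `2 ρ² ≤ 8`. In the others `γ c ≤ 16 C / m`, for a cost of `32 C ρ² ≤ 128 C`.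
  have herr : ∑ i ∈ Finset.range n, 2 * (|γ| * ω.c i) * (γ ^ 2 * ω.x i ^ 2) ≤ 8 + 128 * C := by
    have hterm : ∀ i ∈ Finset.range n, 2 * (|γ| * ω.c i) * (γ ^ 2 * ω.x i ^ 2) ≤
        γ ^ 2 * (if ω.Asq i ≤ l / m then ω.x i ^ 2 else 0) +
          32 * C / m * (γ ^ 2 * ω.x i ^ 2) := by
      intro i hi
      have hi' := Finset.mem_range.1 hi
      have hp : 0 ≤ γ ^ 2 * ω.x i ^ 2 := by positivity
      have hq : 0 ≤ 32 * C / m * (γ ^ 2 * ω.x i ^ 2) := by positivity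
      rw [abs_of_pos hγ0]
      split_ifs with h
      · have := mul_le_mul_of_nonneg_right (hη1 i hi' h) hp
        linarith
      · have := mul_le_mul_of_nonneg_right (hη2 i hi' h) hp
        have e : 32 * C / m = 2 * (16 * C / m) := by ring
        rw [e]; linarith
    refine (Finset.sum_le_sum hterm).trans ?_
    rw [Finset.sum_add_distrib, ← Finset.mul_sum, ← Finset.mul_sum, ← Finset.mul_sum]
    have h3 := (le_min_iff.1 (ω.sum_ite_sq_le hx n hB0.le)).2
    have h4 : ∑ i ∈ Finset.range n, ω.x i ^ 2 = l := rfl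
    have h5 : γ ^ 2 * (2 * (l / m)) = 2 * ρ ^ 2 := by
      have : γ ^ 2 * (2 * (l / m)) = 2 * (γ ^ 2 * l) / m := by ring
      rw [this, hγl2, hDsq]; field_simp
    have h6 : 32 * C / m * (γ ^ 2 * l) = 32 * C * ρ ^ 2 := by
      rw [hγl2, hDsq]; field_simp
    have h7 := mul_le_mul_of_nonneg_left h3 (sq_nonneg γ)
    rw [h4, h6]
    rw [h5] at h7
    have h8 : ρ ^ 2 ≤ 4 := (pow_le_pow_left₀ hρ0.le hρ3 2).trans (by norm_num)
    have := mul_le_mul_of_nonneg_left h8 hC.le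
    linarith
  have hψn : D ≤ ψ l := by
    have h3 : thr ψ m ≤ l := (le_max_left _ _).trans h1
    have h4 := le_sq_of_thr_le hcont hmono hpos hψ h3
    exact Real.sqrt_le_iff.2 ⟨(hpos l ((one_le_thr hψ m).trans h3)).le, h4⟩
  have hgain : D ^ 2 * ρ ≤ γ * ω.S n := by
    have h3 : √l * D ≤ ω.S n :=
      (mul_le_mul_of_nonneg_left hψn (Real.sqrt_nonneg l)).trans hS
    have h4 := mul_le_mul_of_nonneg_left h3 hγ0.le
    rw [← mul_assoc, hγl] at h4
    linarith
  have hsq : D ^ 2 * (ρ - 1) ^ 2 ≤ 1 := by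
    have h3 : D * (ρ - 1) ≤ 1 := by
      have : ρ - 1 ≤ 1 / D := by linarith
      rwa [le_div_iff₀ hD0, mul_comm] at this
    have h4 : 0 ≤ D * (ρ - 1) := mul_nonneg hD0.le (by linarith)
    rw [← mul_pow]
    exact pow_le_one₀ h4 h3
  have hexp : D ^ 2 * (ρ - 1) ^ 2 = D ^ 2 * ρ ^ 2 - 2 * (D ^ 2 * ρ) + D ^ 2 := by ring
  rw [hγl2]
  linarith

lemma summable_gridCard (hψ : Tendsto ψ atTop atTop)
    (hs : Summable fun m : ℕ => lev ψ m * (√m * Real.exp (-m / 2))) :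
    Summable fun m : ℕ => ((gridCard ψ m : ℝ) + 1) * Real.exp (-m / 2) := by
  refine Summable.of_nonneg_of_le (fun m => by positivity) (fun m => ?_)
    ((summable_clev hψ hs).add ((summable_exp_neg_nat_div (c := 2) two_pos).mul_left 2))
  have := (Nat.ceil_lt_add_one (mul_nonneg (clev_nonneg hψ m) (Real.sqrt_nonneg m))).le
  have h2 : (gridCard ψ m : ℝ) ≤ clev ψ m * √m + 1 := this
  nlinarith [Real.exp_pos (-(m : ℝ) / 2)]

lemma exists_level {l : ℝ} {M : ℕ} (hB : cthr ψ M ≤ l) :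
    ∃ m, M ≤ m ∧ cthr ψ m ≤ l ∧ l < cthr ψ (m + 1) := by
  have hex : ∃ k, l < cthr ψ (M + k) := by
    obtain ⟨k, hk1, hk2⟩ := (((tendsto_cthr (ψ := ψ)).eventually_gt_atTop l).and
      (eventually_ge_atTop M)).exists
    exact ⟨k - M, by rwa [Nat.add_sub_cancel' hk2]⟩
  have h0 : Nat.find hex ≠ 0 := fun h => by
    have := Nat.find_spec hex
    rw [h] at this
    exact this.not_ge hB
  refine ⟨M + (Nat.find hex - 1), by omega, not_lt.1 (Nat.find_min hex (by omega)), ?_⟩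
  have : M + (Nat.find hex - 1) + 1 = M + Nat.find hex := by omega
  rw [this]
  exact Nat.find_spec hex

theorem canForce_upper {α : ℝ} (hα : 0 < α) (hcont : ContinuousOn ψ (Set.Ici 1))
    (hmono : MonotoneOn ψ (Set.Ici 1)) (hpos : ∀ t ∈ Set.Ici (1 : ℝ), 0 < ψ t)
    (hI : integralI ψ < ⊤) :
    CanForce α (fun ω => Regular ψ ω →
      ∀ᶠ n in atTop, ω.S n < ω.A n * ψ (ω.Asq n)) := by
  have hψ := tendsto_of_integralI_lt_top hmono hpos hI
  have hs := summable_of_integralI_lt_top hcont hmono hpos hI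
  set W : ℕ → ℝ := fun m => ((gridCard ψ m : ℝ) + 1) * Real.exp (-m / 2) with hW
  have hW0 : ∀ m, 0 < W m := fun m => by positivity
  obtain ⟨h, hh0, hh, hhs⟩ := exists_tendsto_summable_mul hW0 (summable_gridCard hψ hs)
  -- A hit in level `m` yields `exp (-(9 + 128 C)) / W m`. As `C` depends on the path, the target is
  -- lowered to `1 / (W m * √(h m))`; weight times target is then still `√(h m) → ∞`.
  refine canForce_of_hits hα (upperBet ψ) (fun m => combBet_predictable _ _ _ _ _)
    (fun m => h m * W m) (fun m => 1 / (W m * √(h m))) (fun m => mul_pos (hh0 m) (hW0 m)) hhs ?_ ?_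
  · refine (Real.tendsto_sqrt_atTop.comp hh).congr fun m => ?_
    have h1 := Real.sqrt_pos.2 (hh0 m)
    have h2 := hW0 m
    have h3 := Real.sq_sqrt (hh0 m).le
    simp only [Function.comp]
    field_simp
    exact h3
  · intro ω hω
    push Not at hω
    obtain ⟨hreg, hfr⟩ := hω
    obtain ⟨C, hC, n₀, hn₀⟩ := hreg.exists_bounds hmono hψ
    have hbig : ∀ᶠ m : ℕ in atTop, 16 ≤ m ∧ 64 * C ≤ m ∧ thr ψ (m / 3) * m ≤ cthr ψ m ∧
        (4 * (∑ i ∈ Finset.range n₀, ω.c i) ^ 2) * m ≤ cthr ψ m ∧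
        ω.Asq n₀ * m ≤ cthr ψ m ∧ Real.exp (9 + 128 * C) ≤ √(h m) := by
      filter_upwards [eventually_ge_atTop 16,
        tendsto_natCast_atTop_atTop.eventually_ge_atTop (64 * C),
        eventually_thr_mul_le_cthr hψ hs, eventually_mul_le_cthr _, eventually_mul_le_cthr _,
        (Real.tendsto_sqrt_atTop.comp hh).eventually_ge_atTop (Real.exp (9 + 128 * C))]
        with m h1 h2 h3 h4 h5 h6 using ⟨h1, h2, h3, h4, h5, h6⟩
    refine frequently_atTop.2 fun M => ?_
    obtain ⟨M', hM'⟩ := eventually_atTop.1 (hbig.and (eventually_ge_atTop M))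
    obtain ⟨n, hn1, hn2⟩ := (hfr.and_eventually
      (hreg.1.eventually_ge_atTop (cthr ψ M'))).exists
    obtain ⟨m, hm0, hm1, hm2⟩ := exists_level hn2
    obtain ⟨⟨k1, k2, k3, k4, k5, k6⟩, hMm⟩ := hM' m hm0
    refine ⟨m, hMm, n, ?_, fun i _ =>
      combBet_const_prudent _ ⟨0, by simp⟩ _ _ _ ω i⟩
    obtain ⟨j, hj, hle⟩ := exp_le_expCap_of_le_S hcont hmono hpos hψ hC
      hn₀ k1 k2 k3 k4 k5 hm1 hm2 hn1
    refine le_trans ?_ (expCap_le_avg _ _ (fun _ => 0) (fun _ => cthr ψ (m + 1)) hj ω n)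
    refine le_trans ?_ (mul_le_mul_of_nonneg_left hle (by positivity))
    have hpos1 : (0 : ℝ) < (gridCard ψ m : ℝ) + 1 := by positivity
    rw [Finset.card_range, hW, Real.exp_sub]
    push_cast
    simp only [neg_div, Real.exp_neg]
    have e1 := Real.exp_pos ((m : ℝ) / 2)
    have e2 := Real.exp_pos (9 + 128 * C)
    have e3 : 0 < √(h m) := e2.trans_le k6
    rw [div_le_iff₀ (by positivity)]
    field_simp
    exact k6

end Upper

/-! ### Cycles inside a level -/

section Cycles

variable {ψ : ℝ → ℝ}

/-- The number of cycles in the `m`-th level. -/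
noncomputable def numCyc (ψ : ℝ → ℝ) (m : ℕ) : ℕ :=
  min ⌊lev ψ m / (2 * √(m + 1))⌋₊ ⌊Real.exp (m / 2)⌋₊

/-- The value of `A²` at which the `q`-th cycle of the `m`-th level starts. -/
noncomputable def cyc (ψ : ℝ → ℝ) (m q : ℕ) : ℝ := thr ψ m * Real.exp (2 * √(m + 1) * q)

lemma thr_le_cyc (hψ : Tendsto ψ atTop atTop) (m q : ℕ) : thr ψ m ≤ cyc ψ m q :=
  le_mul_of_one_le_right (one_pos.trans_le (one_le_thr hψ m)).le (Real.one_le_exp (by positivity))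

lemma cyc_pos (hψ : Tendsto ψ atTop atTop) (m q : ℕ) : 0 < cyc ψ m q :=
  (one_pos.trans_le (one_le_thr hψ m)).trans_le (thr_le_cyc hψ m q)

lemma cyc_mono (hψ : Tendsto ψ atTop atTop) (m : ℕ) : Monotone (cyc ψ m) := fun q q' h =>
  mul_le_mul_of_nonneg_left (Real.exp_le_exp.2 (by gcongr))
    (one_pos.trans_le (one_le_thr hψ m)).le

lemma cyc_succ (ψ : ℝ → ℝ) (m q : ℕ) :
    cyc ψ m (q + 1) = cyc ψ m q * Real.exp (2 * √(m + 1)) := by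
  rw [cyc, cyc, mul_assoc (thr ψ m), ← Real.exp_add]; push_cast; ring_nf

lemma cyc_le_thr_succ (hψ : Tendsto ψ atTop atTop) {m q : ℕ} (hq : q < numCyc ψ m) :
    cyc ψ m (q + 1) ≤ thr ψ (m + 1) := by
  have hD : 0 < 2 * √((m : ℝ) + 1) := by positivity
  have h1 : q + 1 ≤ ⌊lev ψ m / (2 * √(m + 1))⌋₊ := hq.trans_le (min_le_left _ _)
  have h2 : ((q + 1 : ℕ) : ℝ) ≤ lev ψ m / (2 * √(m + 1)) :=
    (Nat.le_floor_iff (div_nonneg (lev_nonneg hψ m) hD.le)).1 h1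
  rw [le_div_iff₀ hD] at h2
  have h0 : 0 < thr ψ m := one_pos.trans_le (one_le_thr hψ m)
  have h0' : 0 < thr ψ (m + 1) := one_pos.trans_le (one_le_thr hψ (m + 1))
  rw [cyc, ← Real.log_le_log_iff (by positivity) h0', Real.log_mul h0.ne' (Real.exp_pos _).ne',
    Real.log_exp]
  rw [lev] at h2
  linarith

/-- The truncation in `numCyc` keeps the average over all cycles of a level affordable in
`canForce_cycleStartBound`. -/
lemma numCyc_le (ψ : ℝ → ℝ) (m : ℕ) : (numCyc ψ m : ℝ) ≤ Real.exp (m / 2) :=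
  le_trans (by exact_mod_cast min_le_right _ _) (Nat.floor_le (Real.exp_pos _).le)

/-- When a cycle starts, `S` is not too negative. -/
def CycleStartBound (ψ : ℝ → ℝ) (m : ℕ) (ω : Path) : Prop :=
  ∀ q < numCyc ψ m, ∀ n, cyc ψ m q ≤ ω.Asq n → (∀ i < n, ω.Asq i < cyc ψ m q) →
    -(m + 4) * √(cyc ψ m q) ≤ ω.S n

/-- Betting on a decrease with `γ = -1 / √a` turns `S < -(m + 4) √a` into at least `exp (m + 1)`,
which exceeds `exp (m / 2)` even after division by the number of cycles. -/
theorem canForce_cycleStartBound {α : ℝ} (hα : 0 < α) (hcont : ContinuousOn ψ (Set.Ici 1))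
    (hmono : MonotoneOn ψ (Set.Ici 1)) (hpos : ∀ t ∈ Set.Ici (1 : ℝ), 0 < ψ t)
    (hψ : Tendsto ψ atTop atTop) :
    CanForce α (fun ω => Regular ψ ω → ∀ᶠ m in atTop, CycleStartBound ψ m ω) := by
  refine canForce_of_hits hα
    (fun m => combBet (Finset.range (numCyc ψ m))
      (fun _ => ((Finset.range (numCyc ψ m)).card : ℝ)⁻¹)
      (fun q => -(√(cyc ψ m q))⁻¹) (fun _ => 0) (fun q => cyc ψ m q))
    (fun m => combBet_predictable _ _ _ _ _)
    (fun m => Real.exp (-m / 4)) (fun m => Real.exp (m / 2)) (fun m => Real.exp_pos _)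
    (summable_exp_neg_nat_div (by norm_num)) ?_ ?_
  · have : Tendsto (fun m : ℕ => Real.exp ((m : ℝ) / 4)) atTop atTop :=
      Real.tendsto_exp_atTop.comp
        (tendsto_natCast_atTop_atTop.atTop_div_const (by norm_num))
    refine this.congr fun m => ?_
    rw [← Real.exp_add]; ring_nf
  · intro ω hω
    push Not at hω
    obtain ⟨hreg, hfr⟩ := hω
    obtain ⟨C, hC, n₀, hn₀⟩ := hreg.exists_bounds hmono hψ
    have hbig : ∀ᶠ m : ℕ in atTop, (2 * ∑ i ∈ Finset.range n₀, ω.c i) ^ 2 ≤ thr ψ m :=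
      (tendsto_thr hcont hmono hpos hψ).eventually_ge_atTop _
    refine (hfr.and_eventually hbig).mono ?_
    rintro m ⟨hbad, hm⟩
    unfold CycleStartBound at hbad
    push Not at hbad
    obtain ⟨q, hq, n, hn1, hn2, hS⟩ := hbad
    refine ⟨n, ?_, fun i _ => combBet_const_prudent _ ⟨q, Finset.mem_range.2 hq⟩ _ _ _ ω i⟩
    set a := cyc ψ m q with ha
    have ha0 : 0 < a := cyc_pos hψ m q
    have hsa : 0 < √a := Real.sqrt_pos.2 ha0
    have hsmall : ∀ i < n, ω.c i ≤ √a / 2 := by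
      intro i hi
      rcases lt_or_ge i n₀ with h | h
      · have h1 : ω.c i ≤ ∑ i ∈ Finset.range n₀, ω.c i :=
          Finset.single_le_sum (fun k _ => ω.c_nonneg k) (Finset.mem_range.2 h)
        have h2 : 2 * ∑ i ∈ Finset.range n₀, ω.c i ≤ √a :=
          Real.le_sqrt_of_sq_le (hm.trans (thr_le_cyc hψ m q))
        linarith
      · have h1 := (hn₀ i h).2.2
        have h2 := Real.sqrt_le_sqrt (hn2 i hi).le
        linarith
    have hAn : ω.Asq n ≤ 2 * a := by
      rcases n with _ | k
      · simp [Path.Asq, ha0.le]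
      · rw [ω.Asq_succ]
        have h1 := hsmall k k.lt_succ_self
        have h2 := pow_le_pow_left₀ (ω.c_nonneg k) h1 2
        rw [div_pow, Real.sq_sqrt ha0.le] at h2
        linarith [ω.sq_x_le k, hn2 k k.lt_succ_self]
    have hγ : |(-(√a)⁻¹)| = (√a)⁻¹ := by rw [abs_neg, abs_of_pos (inv_pos.2 hsa)]
    have hγ2 : (-(√a)⁻¹) ^ 2 = a⁻¹ := by rw [neg_sq, inv_pow, Real.sq_sqrt ha0.le]
    have hη : ∀ i < n, |(-(√a)⁻¹)| * ω.c i ≤ 1 / 2 := by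
      intro i hi
      rw [hγ, inv_mul_le_iff₀ hsa]
      linarith [hsmall i hi]
    have hle := exp_le_expCap (γ := -(√a)⁻¹) hn2 hη
    have hγA : a⁻¹ * ω.Asq n ≤ 2 := by
      rw [inv_mul_le_iff₀ ha0]; linarith
    have herr : ∑ i ∈ Finset.range n,
        2 * (|(-(√a)⁻¹)| * ω.c i) * ((-(√a)⁻¹) ^ 2 * ω.x i ^ 2) ≤ 2 := by
      have hsum : a⁻¹ * ω.Asq n = ∑ i ∈ Finset.range n, a⁻¹ * ω.x i ^ 2 := by
        rw [← Finset.mul_sum]; rfl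
      rw [hsum] at hγA
      refine (Finset.sum_le_sum fun i hi => ?_).trans hγA
      have h1 := hη i (Finset.mem_range.1 hi)
      rw [hγ2]
      have h2 : 0 ≤ a⁻¹ * ω.x i ^ 2 := by positivity
      nlinarith
    have hgain : (m : ℝ) + 4 ≤ -(√a)⁻¹ * ω.S n := by
      have : (m : ℝ) + 4 ≤ (√a)⁻¹ * (-ω.S n) := by
        rw [le_inv_mul_iff₀ hsa]; linarith
      linarith
    -- From the gain `m + 4` the quadratic term takes at most `1` and the cubic error at most `2`.
    have hE : Real.exp (m + 1) ≤ expCap (-(√a)⁻¹) 0 a ω n := by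
      refine le_trans (Real.exp_le_exp.2 ?_) hle
      rw [hγ2] at herr ⊢
      linarith
    refine le_trans ?_ (expCap_le_avg _ _ (fun _ => 0) (fun q => cyc ψ m q)
      (Finset.mem_range.2 hq) ω n)
    refine le_trans ?_ (mul_le_mul_of_nonneg_left hE (by positivity))
    rw [Finset.card_range]
    have hQ : (0 : ℝ) < numCyc ψ m := by exact_mod_cast (Nat.zero_le q).trans_lt hq
    rw [le_inv_mul_iff₀ hQ]
    calc (numCyc ψ m : ℝ) * Real.exp (m / 2) ≤ Real.exp (m / 2) * Real.exp (m / 2) :=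
          mul_le_mul_of_nonneg_right (numCyc_le ψ m) (Real.exp_pos _).le
      _ ≤ Real.exp (m + 1) := by
          rw [← Real.exp_add]; exact Real.exp_le_exp.2 (by linarith)

/-- The cost of one cycle in the `m`-th level. -/
noncomputable def cost (m : ℕ) : ℝ := (m + 1) * Real.exp (-(m + 1) / 2)

lemma cost_nonneg (m : ℕ) : 0 ≤ cost m := by unfold cost; positivity

lemma summable_cost : Summable cost := by
  refine Summable.of_nonneg_of_le cost_nonneg (fun m => ?_)
    ((summable_exp_neg_nat_div (c := 4) (by norm_num)).mul_left 4)
  have h : (m : ℝ) + 1 ≤ 4 * Real.exp ((m + 1) / 4) := by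
    linarith [Real.add_one_le_exp (((m : ℝ) + 1) / 4)]
  calc cost m ≤ 4 * Real.exp ((m + 1) / 4) * Real.exp (-(m + 1) / 2) :=
        mul_le_mul_of_nonneg_right h (Real.exp_pos _).le
    _ = 4 * Real.exp (-(m + 1) / 4) := by
        rw [mul_assoc, ← Real.exp_add]; ring_nf
    _ ≤ _ := by
        gcongr
        linarith

/-- Truncation does not spoil divergence: in a truncated level `numCyc * cost` exceeds `1` once `m ≥
4`, so under summability only finitely many levels are truncated. Elsewhere `numCyc + 1` is at least
`lev / (2 √(m + 1))`. -/
lemma not_summable_numCyc_mul_cost (hψ : Tendsto ψ atTop atTop)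
    (h : ¬ Summable fun m : ℕ => √(m + 1) * Real.exp (-m / 2) * lev ψ m) :
    ¬ Summable fun m : ℕ => numCyc ψ m * cost m := by
  intro hs
  apply h
  have hmaj := ((hs.add summable_cost).mul_left (2 * Real.exp (1 / 2)))
  refine hmaj.of_norm_bounded_eventually_nat ?_
  filter_upwards [hs.tendsto_atTop_zero.eventually_lt_const one_pos, eventually_ge_atTop 4]
    with m hm hm4
  have hm4' : (4 : ℝ) ≤ m := by exact_mod_cast hm4
  set D := √((m : ℝ) + 1) with hD
  have hD0 : 0 < D := by positivity
  have hD2 : D ^ 2 = m + 1 := Real.sq_sqrt (by positivity)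
  have hexp : Real.exp (1 / 2) * cost m = D ^ 2 * Real.exp (-m / 2) := by
    rw [cost, hD2, mul_left_comm, ← Real.exp_add]; ring_nf
  have hnum : numCyc ψ m = ⌊lev ψ m / (2 * D)⌋₊ := by
    refine min_eq_left (not_lt.1 fun hlt => hm.not_ge ?_)
    have e : numCyc ψ m = ⌊Real.exp (m / 2)⌋₊ := min_eq_right hlt.le
    have h1 : Real.exp ((m : ℝ) / 2) / 2 ≤ numCyc ψ m := by
      rw [e]
      have := Nat.lt_floor_add_one (Real.exp ((m : ℝ) / 2))
      linarith [Real.add_one_le_exp ((m : ℝ) / 2)]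
    have h2 : Real.exp ((m : ℝ) / 2) * Real.exp (-m / 2) = 1 := by
      rw [← Real.exp_add]; ring_nf; exact Real.exp_zero
    have h3 : Real.exp (1 / 2) ≤ 2 := by
      have := Real.exp_one_lt_d9
      have h4 : Real.exp (1 / 2) ^ 2 = Real.exp 1 := by
        rw [← Real.exp_nat_mul]; norm_num
      nlinarith [Real.exp_pos (1 / 2)]
    have h5 := mul_le_mul_of_nonneg_right h1 (cost_nonneg m)
    have h6 : Real.exp (1 / 2) * (Real.exp ((m : ℝ) / 2) / 2 * cost m) = (m + 1) / 2 := by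
      calc _ = Real.exp ((m : ℝ) / 2) / 2 * (Real.exp (1 / 2) * cost m) := by ring
        _ = D ^ 2 / 2 * (Real.exp ((m : ℝ) / 2) * Real.exp (-m / 2)) := by rw [hexp]; ring
        _ = _ := by rw [h2, hD2]; ring
    have h7 : 0 ≤ Real.exp ((m : ℝ) / 2) / 2 * cost m :=
      mul_nonneg (by positivity) (cost_nonneg m)
    nlinarith
  have h1 : lev ψ m ≤ (numCyc ψ m + 1) * (2 * D) := by
    have := (Nat.lt_floor_add_one (lev ψ m / (2 * D))).le
    rw [← hnum, div_le_iff₀ (by positivity)] at this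
    exact this
  rw [Real.norm_of_nonneg (mul_nonneg (by positivity) (lev_nonneg hψ m))]
  calc D * Real.exp (-m / 2) * lev ψ m
      ≤ D * Real.exp (-m / 2) * ((numCyc ψ m + 1) * (2 * D)) :=
        mul_le_mul_of_nonneg_left h1 (by positivity)
    _ = 2 * (numCyc ψ m + 1) * (D ^ 2 * Real.exp (-m / 2)) := by ring
    _ = 2 * Real.exp (1 / 2) * (numCyc ψ m * cost m + cost m) := by rw [← hexp]; ring

lemma exists_le_sum_numCyc_mul_cost
    (h : ¬ Summable fun m : ℕ => numCyc ψ m * cost m) (m₀ : ℕ) (T : ℝ) :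
    ∃ M, m₀ ≤ M ∧ T ≤ ∑ m ∈ Finset.Ico m₀ M, numCyc ψ m * cost m := by
  have h1 := (not_summable_iff_tendsto_nat_atTop_of_nonneg
    (fun m => mul_nonneg (Nat.cast_nonneg _) (cost_nonneg m))).1 h
  obtain ⟨M, hM1, hM2⟩ := ((h1.eventually_ge_atTop
    (T + ∑ m ∈ Finset.range m₀, numCyc ψ m * cost m)).and (eventually_ge_atTop m₀)).exists
  refine ⟨M, hM2, ?_⟩
  rw [Finset.sum_Ico_eq_sub _ hM2]
  linarith

end Cycles

/-! ### Gaussian sums over a geometric grid -/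

/-- Passing to `log ρ` makes the bound translation invariant along a geometric grid. For `ρ ≥ 1 / 2`
one has `|log ρ| ≤ 2 |ρ - 1|`, and with `z = D |ρ - 1|` the inequality `z² / 2 ≥ 4 z - 8` finishes;
for `ρ < 1 / 2` the second term suffices. -/
lemma exp_neg_sq_le {D ρ : ℝ} (hD : 0 ≤ D) (hρ : 0 < ρ) :
    Real.exp (-(D ^ 2 * (ρ - 1) ^ 2 / 2)) ≤
      Real.exp 8 * Real.exp (-|2 * D * Real.log ρ|) + Real.exp (-D ^ 2 / 8) := by
  rw [← Real.exp_add]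
  rcases lt_or_ge ρ (1 / 2) with h | h
  · refine le_trans (Real.exp_le_exp.2 ?_) (le_add_of_nonneg_left (Real.exp_pos _).le)
    have h1 : (1 / 2) ^ 2 ≤ (ρ - 1) ^ 2 := by nlinarith
    nlinarith [mul_le_mul_of_nonneg_left h1 (sq_nonneg D)]
  · refine le_trans (Real.exp_le_exp.2 ?_) (le_add_of_nonneg_right (Real.exp_pos _).le)
    have hlog : |Real.log ρ| ≤ 2 * |ρ - 1| := by
      rcases le_total 1 ρ with h1 | h1
      · rw [abs_of_nonneg (Real.log_nonneg h1), abs_of_nonneg (by linarith)]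
        linarith [Real.log_le_sub_one_of_pos hρ]
      · rw [abs_of_nonpos (Real.log_nonpos hρ.le h1), abs_of_nonpos (by linarith)]
        have h2 := Real.one_sub_inv_le_log_of_pos hρ
        have h3 : ρ⁻¹ - 1 ≤ 2 * (1 - ρ) := by
          have h4 : ρ⁻¹ ≤ 2 := by rw [inv_le_comm₀ hρ two_pos]; linarith
          have h5 : ρ⁻¹ - 1 = ρ⁻¹ * (1 - ρ) := by field_simp
          rw [h5]
          exact mul_le_mul_of_nonneg_right h4 (by linarith)
        linarith
    have hw : |2 * D * Real.log ρ| ≤ 4 * (D * |ρ - 1|) := by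
      rw [abs_mul, abs_of_nonneg (by positivity : 0 ≤ 2 * D)]
      nlinarith [mul_le_mul_of_nonneg_left hlog hD]
    have hsq : (D * |ρ - 1|) ^ 2 = D ^ 2 * (ρ - 1) ^ 2 := by rw [mul_pow, sq_abs]
    nlinarith [sq_nonneg (D * |ρ - 1| - 4)]

lemma exists_sum_exp_neg_abs_le :
    ∃ G : ℝ, ∀ (y : ℝ) (J : ℕ), ∑ k ∈ Finset.range J, Real.exp (-|y - k|) ≤ G := by
  have hs : Summable fun j : ℤ => Real.exp (-|(j : ℝ)|) := by
    have h1 : Summable fun n : ℕ => Real.exp (-(n : ℝ) / 1) := summable_exp_neg_nat_div one_pos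
    refine Summable.of_nat_of_neg ?_ ?_ <;>
      · refine h1.congr fun n => ?_
        simp
  refine ⟨Real.exp 1 * ∑' j : ℤ, Real.exp (-|(j : ℝ)|), fun y J => ?_⟩
  calc ∑ k ∈ Finset.range J, Real.exp (-|y - k|)
      ≤ ∑ k ∈ Finset.range J, Real.exp 1 * Real.exp (-|((⌊y⌋ - (k : ℤ) : ℤ) : ℝ)|) := by
        refine Finset.sum_le_sum fun k _ => ?_
        rw [← Real.exp_add]
        refine Real.exp_le_exp.2 ?_
        push_cast
        have h1 := Int.floor_le y
        have h2 := Int.lt_floor_add_one y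
        have h3 : |(⌊y⌋ : ℝ) - k| ≤ |y - k| + |(⌊y⌋ : ℝ) - y| := by
          have := abs_add_le (y - k) ((⌊y⌋ : ℝ) - y)
          rwa [show y - k + ((⌊y⌋ : ℝ) - y) = (⌊y⌋ : ℝ) - k by ring] at this
        have h4 : |(⌊y⌋ : ℝ) - y| ≤ 1 := abs_le.2 ⟨by linarith, by linarith⟩
        linarith
    _ = Real.exp 1 * ∑ j ∈ (Finset.range J).image (fun k : ℕ => ⌊y⌋ - (k : ℤ)),
          Real.exp (-|(j : ℝ)|) := by
        rw [← Finset.mul_sum, Finset.sum_image]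
        intro a _ b _ hab
        simp only at hab
        omega
    _ ≤ _ := mul_le_mul_of_nonneg_left
        (hs.sum_le_tsum _ fun j _ => (Real.exp_pos _).le) (Real.exp_pos _).le

/-! ### The divergence half -/

section Lower

variable {ψ : ℝ → ℝ}

/-- The grid points of the `q`-th cycle of the `m`-th level. -/
noncomputable def cycPt (ψ : ℝ → ℝ) (m q k : ℕ) : ℝ :=
  cyc ψ m q * (4 * (m + 1) ^ 3) * Real.exp (k / √(m + 1))

/-- The factor `4 (m + 1)³` in the grid makes `S` at the start of the cycle negligible after
multiplication by `γ`. The bets end at `16 l`, where `√t / √l ≥ 4` and the capital has become tiny.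
-/
noncomputable def cycCap (ψ : ℝ → ℝ) (m q k : ℕ) : Path → ℕ → ℝ :=
  expCap (√(m + 1) / √(cycPt ψ m q k)) (cyc ψ m q) (16 * cycPt ψ m q k)

/-- Levels at which all estimates for the cycles are valid. -/
structure LargeLevel (C : ℝ) (m : ℕ) : Prop where
  one_le : 1 ≤ m
  bet_small : 64 * C ≤ m + 1
  grid_fits : 68 * ((m : ℝ) + 1) ^ 3 ≤ Real.exp √(m + 1)
  decay : 4 + 1088 * C ≤ 4 * (m + 1)

lemma eventually_largeLevel (C : ℝ) : ∀ᶠ m in atTop, LargeLevel C m := by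
  have h1 : Tendsto (fun m : ℕ => √((m : ℝ) + 1)) atTop atTop :=
    Real.tendsto_sqrt_atTop.comp
      (tendsto_atTop_add_const_right _ _ tendsto_natCast_atTop_atTop)
  filter_upwards [eventually_ge_atTop 1,
    tendsto_natCast_atTop_atTop.eventually_ge_atTop (64 * C),
    tendsto_natCast_atTop_atTop.eventually_ge_atTop (1 + 272 * C),
    ((Real.tendsto_exp_div_pow_atTop 6).comp h1).eventually_ge_atTop 68] with m a b c d
  refine ⟨a, by linarith, ?_, by linarith⟩
  simp only [Function.comp] at d
  have h0 : (0 : ℝ) < m + 1 := by positivity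
  have e : √((m : ℝ) + 1) ^ 6 = ((m : ℝ) + 1) ^ 3 := by
    rw [show 6 = 2 * 3 by norm_num, pow_mul, Real.sq_sqrt h0.le]
  rw [e, le_div_iff₀ (by positivity)] at d
  exact d

/-- Paths on which Skeptic gains in the cycles of the `m`-th level. -/
structure LowerPath (ψ : ℝ → ℝ) (C : ℝ) (n₀ m : ℕ) (ω : Path) : Prop where
  bound : ∀ i, n₀ ≤ i → 1 ≤ ω.Asq i ∧ ω.c i * ψ (ω.Asq i) ^ 3 ≤ C * √(ω.Asq i) ∧
    ω.c i ≤ √(ω.Asq i) / 8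
  below : ∀ n, n₀ ≤ n → ω.S n < ω.A n * ψ (ω.Asq n)
  started : ω.Asq n₀ < thr ψ m
  low : CycleStartBound ψ m ω

lemma cycPt_pos (hψ : Tendsto ψ atTop atTop) (m q k : ℕ) : 0 < cycPt ψ m q k :=
  mul_pos (mul_pos (cyc_pos hψ m q) (by positivity)) (Real.exp_pos _)

lemma cyc_mul_le_cycPt (hψ : Tendsto ψ atTop atTop) (m q k : ℕ) :
    cyc ψ m q * (4 * (m + 1) ^ 3) ≤ cycPt ψ m q k :=
  le_mul_of_one_le_right (mul_pos (cyc_pos hψ m q) (by positivity)).le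
    (Real.one_le_exp (by positivity))

/-- The factor `17` allows for the overshoot above `16 l`. The grid uses up one factor `exp √(m +
1)` of the cycle, and `grid_fits` fits the constants into the other. -/
lemma cycPt_lt (hψ : Tendsto ψ atTop atTop) {C : ℝ} {m q k : ℕ} (hm : LargeLevel C m)
    (hk : k < m + 1) : 17 * cycPt ψ m q k < cyc ψ m (q + 1) := by
  have ha := cyc_pos hψ m q
  rw [cycPt, cyc_succ, two_mul, Real.exp_add]
  set D := √((m : ℝ) + 1) with hD
  have hD0 : 0 < D := by positivity
  have hD2 : D ^ 2 = m + 1 := Real.sq_sqrt (by positivity)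
  have h1 : Real.exp (k / D) < Real.exp D := by
    refine Real.exp_lt_exp.2 ?_
    rw [div_lt_iff₀ hD0, ← sq, hD2]
    exact_mod_cast hk
  calc 17 * (cyc ψ m q * (4 * (m + 1) ^ 3) * Real.exp (k / D))
      = cyc ψ m q * (68 * ((m : ℝ) + 1) ^ 3 * Real.exp (k / D)) := by ring
    _ < cyc ψ m q * (Real.exp D * Real.exp D) := by
        refine mul_lt_mul_of_pos_left ?_ ha
        exact mul_lt_mul' hm.grid_fits h1 (Real.exp_pos _).le (Real.exp_pos _)
    _ = _ := by ring

lemma Path.Asq_le_of_prev {ω : Path} {i : ℕ} (h : ω.c i ≤ √(ω.Asq i) / 8) :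
    ω.Asq (i + 1) ≤ 17 / 16 * ω.Asq i := by
  have h2 := pow_le_pow_left₀ (ω.c_nonneg i) h 2
  rw [div_pow, Real.sq_sqrt (ω.Asq_nonneg i)] at h2
  rw [ω.Asq_succ]
  linarith [ω.sq_x_le i, ω.Asq_nonneg i]

/-- First index at which `A²` reaches the value `a`. -/
lemma Path.exists_first {ω : Path} {a : ℝ} {n : ℕ} (h : a ≤ ω.Asq n) :
    ∃ k ≤ n, a ≤ ω.Asq k ∧ ∀ i < k, ω.Asq i < a := by
  have hex : ∃ k, a ≤ ω.Asq k := ⟨n, h⟩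
  exact ⟨Nat.find hex, Nat.find_min' hex h, Nat.find_spec hex,
    fun i hi => not_le.1 (Nat.find_min hex hi)⟩

/-- The relative size of the bets during a cycle. -/
lemma LowerPath.bet_le (hcont : ContinuousOn ψ (Set.Ici 1))
    (hmono : MonotoneOn ψ (Set.Ici 1)) (hpos : ∀ t ∈ Set.Ici (1 : ℝ), 0 < ψ t)
    (hψ : Tendsto ψ atTop atTop) {C : ℝ} (hC : 0 < C) {n₀ m q k : ℕ} {ω : Path}
    (hm : LargeLevel C m) (hω : LowerPath ψ C n₀ m ω) {i : ℕ} (hi : n₀ ≤ i)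
    (h1 : cyc ψ m q ≤ ω.Asq i) (h2 : ω.Asq i ≤ 16 * cycPt ψ m q k) :
    √(m + 1) / √(cycPt ψ m q k) * ω.c i ≤ 32 * C / (m + 1) := by
  have hl := cycPt_pos hψ m q k
  have hsl : 0 < √(cycPt ψ m q k) := Real.sqrt_pos.2 hl
  have hm1 : (1 : ℝ) ≤ m := by exact_mod_cast hm.one_le
  have hm0 : (0 : ℝ) < m + 1 := by positivity
  set D := √((m : ℝ) + 1) with hD
  have hD0 : 0 < D := Real.sqrt_pos.2 hm0
  have hD2 : D ^ 2 = m + 1 := Real.sq_sqrt hm0.le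
  obtain ⟨h3, h4, -⟩ := hω.bound i hi
  have hψi := hpos _ (Set.mem_Ici.2 h3)
  have h5 := le_sq_of_thr_le hcont hmono hpos hψ ((thr_le_cyc hψ m q).trans h1)
  have h6 : D / 2 ≤ ψ (ω.Asq i) := by
    refine abs_le_of_sq_le_sq' ?_ hψi.le |>.2
    rw [div_pow, hD2]; linarith
  have h7 : √(ω.Asq i) ≤ 4 * √(cycPt ψ m q k) := by
    rw [Real.sqrt_le_iff]
    refine ⟨by positivity, ?_⟩
    rw [mul_pow, Real.sq_sqrt hl.le]; linarith
  have h8 : ω.c i * (D / 2) ^ 3 ≤ C * (4 * √(cycPt ψ m q k)) :=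
    (mul_le_mul_of_nonneg_left (pow_le_pow_left₀ (by positivity) h6 3) (ω.c_nonneg i)).trans
      (h4.trans (mul_le_mul_of_nonneg_left h7 hC.le))
  rw [le_div_iff₀ hm0, div_mul_eq_mul_div, div_mul_eq_mul_div, div_le_iff₀ hsl, ← hD2]
  linarith

/-- Here `t` is `A²` when the bets end, or at time `n` if they are still on. With `ρ = √t / √l`, the
barrier gives `γ S ≤ (m + 1) ρ`, and completing the square produces the Gaussian. The constant `3 +
1088 C` covers `2` from `S` at the start, `1 / 2` from `A²` at the start and `1088 C` from the cubic
errors. -/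
lemma LowerPath.cycCap_le (hcont : ContinuousOn ψ (Set.Ici 1))
    (hmono : MonotoneOn ψ (Set.Ici 1)) (hpos : ∀ t ∈ Set.Ici (1 : ℝ), 0 < ψ t)
    (hψ : Tendsto ψ atTop atTop) {C : ℝ} (hC : 0 < C) {n₀ m q k : ℕ} {ω : Path}
    (hm : LargeLevel C m) (hω : LowerPath ψ C n₀ m ω) (hq : q < numCyc ψ m) (hk : k < m + 1)
    {n : ℕ} (hn : cyc ψ m q ≤ ω.Asq n) :
    ∃ t, (t = ω.Asq n ∨ 16 * cycPt ψ m q k ≤ t) ∧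
      (16 * cycPt ψ m q k ≤ ω.Asq n → 16 * cycPt ψ m q k ≤ t) ∧ 0 < t ∧
      cycCap ψ m q k ω n ≤ Real.exp (3 + 1088 * C + ((m : ℝ) + 1) / 2 -
        ((m + 1) * (√t / √(cycPt ψ m q k) - 1) ^ 2 / 2)) := by
  set a := cyc ψ m q with ha
  set l := cycPt ψ m q k with hldef
  have ha0 : 0 < a := cyc_pos hψ m q
  have hl : 0 < l := cycPt_pos hψ m q k
  have hsl : 0 < √l := Real.sqrt_pos.2 hl
  have hm1 : (1 : ℝ) ≤ m := by exact_mod_cast hm.one_le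
  have hm0 : (0 : ℝ) < m + 1 := by positivity
  set D := √((m : ℝ) + 1) with hD
  have hD0 : 0 < D := Real.sqrt_pos.2 hm0
  have hD2 : D ^ 2 = m + 1 := Real.sq_sqrt hm0.le
  have hal : a * (4 * (m + 1) ^ 3) ≤ l := cyc_mul_le_cycPt hψ m q k
  have hp1 : (1 : ℝ) ≤ (m + 1) ^ 2 := one_le_pow₀ (by linarith)
  have hal' : 4 * ((m + 1) * a) ≤ l := by
    refine le_trans ?_ hal
    have := mul_le_mul_of_nonneg_left hp1 (mul_pos ha0 hm0).le
    nlinarith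
  have hal'' : 4 * a ≤ l := by nlinarith
  -- the start of the cycle
  obtain ⟨n₁, hn₁, hA₁, hlt₁⟩ := ω.exists_first hn
  have hstart : ω.Asq n₀ < a := hω.started.trans_le (thr_le_cyc hψ m q)
  have h01 : n₀ < n₁ := by
    by_contra! h
    exact (hA₁.trans (ω.Asq_mono h)).not_gt hstart
  have hA₁' : ω.Asq n₁ ≤ 2 * a := by
    -- The round before `n₁` is not earlier than `n₀`, so its overshoot is bounded.
    obtain ⟨j, rfl⟩ : ∃ j, n₁ = j + 1 := ⟨n₁ - 1, by omega⟩
    have := ω.Asq_le_of_prev (hω.bound j (by omega)).2.2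
    linarith [hlt₁ j j.lt_succ_self]
  have hS₁ : -(m + 4) * √a ≤ ω.S n₁ := hω.low q hq n₁ hA₁ hlt₁
  -- the end of the bets
  obtain ⟨n₂, h12, h2n, hafter, hbefore, ht1, ht2, ht3⟩ : ∃ n₂, n₁ ≤ n₂ ∧ n₂ ≤ n ∧
      (∀ i, n₂ ≤ i → i < n → 16 * l ≤ ω.Asq i) ∧ (∀ i < n₂, ω.Asq i < 16 * l) ∧
      (ω.Asq n₂ = ω.Asq n ∨ 16 * l ≤ ω.Asq n₂) ∧
      (16 * l ≤ ω.Asq n → 16 * l ≤ ω.Asq n₂) ∧ ω.Asq n₂ ≤ 17 * l := by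
    rcases lt_or_ge (ω.Asq n) (16 * l) with h | h
    · exact ⟨n, hn₁, le_rfl, fun i h1 h2 => by omega,
        fun i hi => (ω.Asq_mono hi.le).trans_lt h, Or.inl rfl, fun h' => h', by linarith⟩
    · obtain ⟨n₂, hn₂, hA₂, hlt₂⟩ := ω.exists_first h
      have h12 : n₁ ≤ n₂ := by
        by_contra! h'
        linarith [hlt₁ n₂ h']
      refine ⟨n₂, h12, hn₂, fun i h1 _ => hA₂.trans (ω.Asq_mono h1), hlt₂, Or.inr hA₂,
        fun _ => hA₂, ?_⟩
      obtain ⟨j, rfl⟩ : ∃ j, n₂ = j + 1 := ⟨n₂ - 1, by omega⟩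
      have := ω.Asq_le_of_prev (hω.bound j (by omega)).2.2
      linarith [hlt₂ j j.lt_succ_self]
  have hat : a ≤ ω.Asq n₂ := hA₁.trans (ω.Asq_mono h12)
  have ht0 : 0 < ω.Asq n₂ := ha0.trans_le hat
  refine ⟨ω.Asq n₂, ht1, ht2, ht0, ?_⟩
  set t := ω.Asq n₂ with htdef
  set η := 32 * C / (m + 1) with hη
  have hη0 : 0 ≤ η := by positivity
  have hη1 : η ≤ 1 / 2 := by
    rw [hη, div_le_iff₀ hm0]; linarith [hm.bet_small]
  set γ := D / √l with hγ
  have hγ0 : 0 < γ := div_pos hD0 hsl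
  refine (expCap_le_exp hγ0.le h12 h2n hlt₁ hafter
    (fun i hi1 hi2 => ⟨hA₁.trans (ω.Asq_mono hi1), hbefore i hi2⟩) hη1
    (fun i hi1 hi2 => hω.bet_le hcont hmono hpos hψ hC hm (by omega)
      (hA₁.trans (ω.Asq_mono hi1)) (hbefore i hi2).le)).trans (Real.exp_le_exp.2 ?_)
  set ρ := √t / √l with hρ
  have hρ0 : 0 < ρ := div_pos (Real.sqrt_pos.2 ht0) hsl
  have hγt : γ * √t = D * ρ := by rw [hγ, hρ]; ring
  have hγt2 : γ ^ 2 * t = (m + 1) * ρ ^ 2 := by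
    rw [← hD2, ← mul_pow, ← hγt, mul_pow, Real.sq_sqrt ht0.le]
  have hγl : γ ^ 2 * l = m + 1 := by
    rw [hγ, div_pow, Real.sq_sqrt hl.le, hD2]; field_simp
  -- the estimate of `S` at the end
  have hSn : γ * ω.S n₂ ≤ (m + 1) * ρ := by
    have hlt : t < thr ψ (m + 1) := by
      refine (ht3.trans_lt (cycPt_lt hψ hm hk)).trans_le (cyc_le_thr_succ hψ hq)
    have h1 : 1 ≤ t := (one_le_thr hψ m).trans ((thr_le_cyc hψ m q).trans hat)
    have h2 := sq_lt_of_lt_thr h1 hlt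
    push_cast at h2
    have h3 : ψ t ≤ D := Real.le_sqrt_of_sq_le h2.le
    have h4 : ω.S n₂ ≤ √t * D :=
      (hω.below n₂ (by omega)).le.trans (mul_le_mul_of_nonneg_left h3 (Real.sqrt_nonneg _))
    have h5 := mul_le_mul_of_nonneg_left h4 hγ0.le
    rw [← mul_assoc, hγt] at h5
    linarith [hD2, show D * ρ * D = (m + 1) * ρ by rw [← hD2]; ring]
  -- the estimate of `S` at the start
  have hS1 : -2 ≤ γ * ω.S n₁ := by
    have h1 : √a * (2 * (D * (m + 1))) ≤ √l := by
      refine Real.le_sqrt_of_sq_le (le_trans (le_of_eq ?_) hal)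
      rw [mul_pow, mul_pow, mul_pow, Real.sq_sqrt ha0.le, hD2]; ring
    have h2 : γ * ((m + 4) * √a) ≤ 2 := by
      rw [hγ, div_mul_eq_mul_div, div_le_iff₀ hsl]
      have h3 : 0 ≤ √a * D := by positivity
      nlinarith
    have h3 := mul_le_mul_of_nonneg_left hS₁ hγ0.le
    linarith
  have hA1 : γ ^ 2 * ω.Asq n₁ ≤ 1 := by
    have h1 := mul_le_mul_of_nonneg_left hA₁' (sq_nonneg γ)
    have h2 : γ ^ 2 * (4 * ((m + 1) * a)) ≤ m + 1 :=
      (mul_le_mul_of_nonneg_left hal' (sq_nonneg γ)).trans hγl.le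
    have h3 : (m + 1) * (4 * (γ ^ 2 * a)) ≤ (m + 1) * 1 := by linarith
    linarith [le_of_mul_le_mul_left h3 hm0]
  have herr : 2 * η * (γ ^ 2 * t) ≤ 1088 * C := by
    have h1 := mul_le_mul_of_nonneg_left ht3 (sq_nonneg γ)
    have h2 : γ ^ 2 * t ≤ 17 * (m + 1) := by linarith
    have h3 : 2 * η * (17 * (m + 1)) = 1088 * C := by rw [hη]; field_simp; norm_num
    rw [← h3]
    exact mul_le_mul_of_nonneg_left h2 (by positivity)
  have hηA : 0 ≤ η * (γ ^ 2 * ω.Asq n₁) :=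
    mul_nonneg hη0 (mul_nonneg (sq_nonneg γ) (ω.Asq_nonneg _))
  have e1 : γ ^ 2 * (1 / 2 - 2 * η) * (t - ω.Asq n₁) = (m + 1) * ρ ^ 2 / 2 -
      2 * η * (γ ^ 2 * t) - γ ^ 2 * ω.Asq n₁ / 2 + 2 * (η * (γ ^ 2 * ω.Asq n₁)) := by
    rw [← hγt2]; ring
  have e2 : ((m : ℝ) + 1) * (ρ - 1) ^ 2 = (m + 1) * ρ ^ 2 - 2 * ((m + 1) * ρ) + (m + 1) := by
    ring
  rw [e1, e2]
  linarith

/-- The capital that Skeptic sells in the `q`-th cycle of the `m`-th level. -/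
noncomputable def cycSum (ψ : ℝ → ℝ) (m q : ℕ) (ω : Path) (n : ℕ) : ℝ :=
  ∑ k ∈ Finset.range (m + 1), Real.exp (-(m + 1) / 2) * cycCap ψ m q k ω n

lemma expCap_eq_one {γ a b : ℝ} {ω : Path} {n : ℕ} (h : ω.Asq n < a) : expCap γ a b ω n = 1 :=
  Finset.prod_eq_one fun i hi => by
    have hg : gate γ a b ω i = 0 := if_neg fun h' =>
      ((ω.Asq_mono (Finset.mem_range.1 hi).le).trans_lt h).not_ge h'.1
    rw [hg]; simp

lemma cycSum_eq_cost {m q : ℕ} {ω : Path} {n : ℕ} (h : ω.Asq n < cyc ψ m q) :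
    cycSum ψ m q ω n = cost m := by
  simp [cycSum, cycCap, expCap_eq_one h, cost]

lemma nine_le_sq_sqrt_div_sub_one {l t : ℝ} (hl : 0 < l) (h : 16 * l ≤ t) : 9 ≤ (√t / √l - 1) ^ 2 := by
  have h1 : 4 ≤ √t / √l := by
    rw [le_div_iff₀ (Real.sqrt_pos.2 hl)]
    refine Real.le_sqrt_of_sq_le ?_
    rw [mul_pow, Real.sq_sqrt hl.le]; linarith
  nlinarith

/-- After the cycle every `ρ` is at least `4`, so each exponent is at most `3 + 1088 C - 4 (m + 1) ≤
-1`, and `exp (-1) ≤ 1 / 2`. -/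
lemma LowerPath.cycSum_le_half_cost (hcont : ContinuousOn ψ (Set.Ici 1))
    (hmono : MonotoneOn ψ (Set.Ici 1)) (hpos : ∀ t ∈ Set.Ici (1 : ℝ), 0 < ψ t)
    (hψ : Tendsto ψ atTop atTop) {C : ℝ} (hC : 0 < C) {n₀ m q : ℕ} {ω : Path}
    (hm : LargeLevel C m) (hω : LowerPath ψ C n₀ m ω) (hq : q < numCyc ψ m)
    {n : ℕ} (hn : cyc ψ m (q + 1) ≤ ω.Asq n) : cycSum ψ m q ω n ≤ cost m / 2 := by
  have e : cost m / 2 = ∑ k ∈ Finset.range (m + 1), Real.exp (-(m + 1) / 2) * (1 / 2) := by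
    rw [Finset.sum_const, Finset.card_range, nsmul_eq_mul, cost]; push_cast; ring
  rw [e]
  refine Finset.sum_le_sum fun k hk => mul_le_mul_of_nonneg_left ?_ (Real.exp_pos _).le
  have hk' := Finset.mem_range.1 hk
  have hl := cycPt_pos hψ m q k
  obtain ⟨t, -, ht2, -, hle⟩ := hω.cycCap_le hcont hmono hpos hψ hC hm hq hk'
    ((cyc_mono hψ m q.le_succ).trans hn)
  have h1 := nine_le_sq_sqrt_div_sub_one hl (ht2 (by linarith [cycPt_lt (q := q) hψ hm hk']))
  have h2 : Real.exp (-1) ≤ 1 / 2 := by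
    have h3 : Real.exp (-1) * Real.exp 1 = 1 := by rw [← Real.exp_add]; simp
    nlinarith [Real.add_one_le_exp (1 : ℝ), Real.exp_pos (-1)]
  refine hle.trans (le_trans (Real.exp_le_exp.2 ?_) h2)
  have h4 := mul_le_mul_of_nonneg_left h1 (by positivity : (0 : ℝ) ≤ m + 1)
  linarith [hm.decay]

/-- The weight `exp (-(m + 1) / 2)` cancels the Gaussian peak, leaving a sum over unit-spaced points
that is bounded independently of `m`, plus `m + 1` remainders of size `exp (-(m + 1) / 8)`. -/
lemma exists_cycSum_le (hcont : ContinuousOn ψ (Set.Ici 1))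
    (hmono : MonotoneOn ψ (Set.Ici 1)) (hpos : ∀ t ∈ Set.Ici (1 : ℝ), 0 < ψ t)
    (hψ : Tendsto ψ atTop atTop) {C : ℝ} (hC : 0 < C) :
    ∃ B > 0, ∀ {n₀ m q : ℕ} {ω : Path}, LargeLevel C m → LowerPath ψ C n₀ m ω →
      q < numCyc ψ m → ∀ n, cyc ψ m q ≤ ω.Asq n → cycSum ψ m q ω n ≤ B := by
  obtain ⟨G, hG⟩ := exists_sum_exp_neg_abs_le
  have hG0 : 0 ≤ G := by simpa using hG 0 0
  refine ⟨Real.exp (3 + 1088 * C) * (Real.exp 8 * G + 8), by positivity, ?_⟩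
  intro n₀ m q ω hm hω hq n hn
  have hm0 : (0 : ℝ) < m + 1 := by positivity
  set D := √((m : ℝ) + 1) with hD
  have hD0 : 0 < D := Real.sqrt_pos.2 hm0
  have hD2 : D ^ 2 = m + 1 := Real.sq_sqrt hm0.le
  have hbase : 0 < cyc ψ m q * (4 * ((m : ℝ) + 1) ^ 3) :=
    mul_pos (cyc_pos hψ m q) (by positivity)
  set y := D * (Real.log (ω.Asq n) - Real.log (cyc ψ m q * (4 * ((m : ℝ) + 1) ^ 3))) with hy
  have hterm : ∀ k ∈ Finset.range (m + 1), Real.exp (-(m + 1) / 2) * cycCap ψ m q k ω n ≤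
      Real.exp (3 + 1088 * C) *
        (Real.exp 8 * Real.exp (-|y - k|) + Real.exp (-(m + 1) / 8)) := by
    intro k hk
    have hl := cycPt_pos hψ m q k
    have hsl := Real.sqrt_pos.2 hl
    obtain ⟨t, ht1, -, ht0, hle⟩ :=
      hω.cycCap_le hcont hmono hpos hψ hC hm hq (Finset.mem_range.1 hk) hn
    set ρ := √t / √(cycPt ψ m q k) with hρ
    have hρ0 : 0 < ρ := div_pos (Real.sqrt_pos.2 ht0) hsl
    have h1 : Real.exp (-(m + 1) / 2) * cycCap ψ m q k ω n ≤
        Real.exp (3 + 1088 * C) * Real.exp (-(D ^ 2 * (ρ - 1) ^ 2 / 2)) := by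
      refine (mul_le_mul_of_nonneg_left hle (Real.exp_pos _).le).trans (le_of_eq ?_)
      rw [← Real.exp_add, ← Real.exp_add, hD2]; ring_nf
    refine h1.trans (mul_le_mul_of_nonneg_left ?_ (Real.exp_pos _).le)
    rcases ht1 with ht | ht
    -- The logarithmic grid step is `1 / D`, so `2 D log ρ` decreases by exactly `1` from one grid
    -- point to the next.
    · have h2 : 2 * D * Real.log ρ = y - k := by
        rw [hρ, Real.log_div (Real.sqrt_pos.2 ht0).ne' hsl.ne', Real.log_sqrt ht0.le,
          Real.log_sqrt hl.le, hy, ← ht, cycPt, Real.log_mul hbase.ne' (Real.exp_pos _).ne',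
          Real.log_exp, ← hD]
        field_simp
        ring
      rw [← h2, ← hD2]
      exact exp_neg_sq_le hD0.le hρ0
    · refine le_trans (Real.exp_le_exp.2 ?_) (le_add_of_nonneg_left (by positivity))
      have h3 := mul_le_mul_of_nonneg_left (nine_le_sq_sqrt_div_sub_one hl ht) (sq_nonneg D)
      rw [← hρ] at h3
      rw [← hD2]
      linarith [sq_nonneg D]
  refine (Finset.sum_le_sum hterm).trans ?_
  rw [← Finset.mul_sum]
  refine mul_le_mul_of_nonneg_left ?_ (Real.exp_pos _).le
  rw [Finset.sum_add_distrib, ← Finset.mul_sum, Finset.sum_const, Finset.card_range, nsmul_eq_mul]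
  refine add_le_add (mul_le_mul_of_nonneg_left (hG y (m + 1)) (Real.exp_pos _).le) ?_
  have h5 : ((m : ℝ) + 1) ≤ 8 * Real.exp ((m + 1) / 8) := by
    linarith [Real.add_one_le_exp (((m : ℝ) + 1) / 8)]
  calc ((m + 1 : ℕ) : ℝ) * Real.exp (-(m + 1) / 8)
      ≤ 8 * Real.exp ((m + 1) / 8) * Real.exp (-(m + 1) / 8) := by
        push_cast
        exact mul_le_mul_of_nonneg_right h5 (Real.exp_pos _).le
    _ = 8 := by rw [mul_assoc, ← Real.exp_add, neg_div, add_neg_cancel, Real.exp_zero, mul_one]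

/-- The cycles of the levels `m₀ ≤ m < M`. -/
noncomputable def cycles (ψ : ℝ → ℝ) (m₀ M : ℕ) : Finset (Σ _ : ℕ, ℕ) :=
  (Finset.Ico m₀ M).sigma fun m => Finset.range (numCyc ψ m)

/-- At any time at most one cycle is under way. -/
lemma sum_cycles_ite_le (hψ : Tendsto ψ atTop atTop) (m₀ M : ℕ) (l : ℝ) {B : ℝ} (hB : 0 ≤ B) :
    ∑ p ∈ cycles ψ m₀ M,
      (if cyc ψ p.1 p.2 ≤ l ∧ l < cyc ψ p.1 (p.2 + 1) then B else 0) ≤ B := by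
  classical
  rw [← Finset.sum_filter, Finset.sum_const, nsmul_eq_mul]
  refine mul_le_of_le_one_left hB ?_
  have : (Finset.filter (fun p : Σ _ : ℕ, ℕ => cyc ψ p.1 p.2 ≤ l ∧ l < cyc ψ p.1 (p.2 + 1))
      (cycles ψ m₀ M)).card ≤ 1 := by
    rw [Finset.card_le_one]
    have key : ∀ m m' q q' : ℕ, q < numCyc ψ m → l < cyc ψ m (q + 1) → cyc ψ m' q' ≤ l →
        ¬ m < m' := fun m m' q q' hq h1 h2 hlt =>
      absurd h2 (not_le.2 (h1.trans_le ((cyc_le_thr_succ hψ hq).trans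
        ((thr_mono hψ hlt).trans (thr_le_cyc hψ m' q')))))
    rintro ⟨m, q⟩ hp ⟨m', q'⟩ hp'
    simp only [Finset.mem_filter, cycles, Finset.mem_sigma, Finset.mem_range] at hp hp'
    obtain ⟨⟨-, hq⟩, h1, h2⟩ := hp
    obtain ⟨⟨-, hq'⟩, h1', h2'⟩ := hp'
    obtain rfl : m = m' :=
      le_antisymm (not_lt.1 (key m' m q' q hq' h2' h1)) (not_lt.1 (key m m' q q' hq h2 h1'))
    have key2 : ∀ q q' : ℕ, l < cyc ψ m (q + 1) → cyc ψ m q' ≤ l → ¬ q < q' :=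
      fun q q' h1 h2 hlt => absurd h2 (not_le.2 (h1.trans_le (cyc_mono hψ m hlt)))
    obtain rfl : q = q' :=
      le_antisymm (not_lt.1 (key2 q' q h2' h1)) (not_lt.1 (key2 q q' h2 h1'))
    rfl
  exact_mod_cast this

/-- Skeptic sells the exponential capitals of all cycles of the levels `m₀ ≤ m < M`. -/
noncomputable def lowerBet (ψ : ℝ → ℝ) (ε : ℝ) (m₀ M : ℕ) : Path → ℕ → ℝ :=
  combBet ((cycles ψ m₀ M).sigma fun p => Finset.range (p.1 + 1))
    (fun x => -(ε * Real.exp (-(x.1.1 + 1) / 2)))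
    (fun x => √(x.1.1 + 1) / √(cycPt ψ x.1.1 x.1.2 x.2)) (fun x => cyc ψ x.1.1 x.1.2)
    (fun x => 16 * cycPt ψ x.1.1 x.1.2 x.2)

lemma wealth_lowerBet (ψ : ℝ → ℝ) (ε : ℝ) (m₀ M : ℕ) (ω : Path) (n : ℕ) :
    wealth 1 (lowerBet ψ ε m₀ M) ω n =
      1 + ε * ∑ p ∈ cycles ψ m₀ M, (cost p.1 - cycSum ψ p.1 p.2 ω n) := by
  rw [lowerBet, wealth_combBet, Finset.sum_sigma, Finset.mul_sum]
  congr 1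
  refine Finset.sum_congr rfl fun p _ => ?_
  have e : cost p.1 = ∑ k ∈ Finset.range (p.1 + 1), Real.exp (-((p.1 : ℝ) + 1) / 2) := by
    rw [Finset.sum_const, Finset.card_range, nsmul_eq_mul, cost]; push_cast; ring
  rw [e, cycSum, ← Finset.sum_sub_distrib, Finset.mul_sum]
  refine Finset.sum_congr rfl fun k _ => ?_
  rw [cycCap]; ring

lemma abs_lowerBet_mul_c_le (hψ : Tendsto ψ atTop atTop) {C ε : ℝ} (hε : 0 ≤ ε) {m₀ M : ℕ}
    (hm₀ : ∀ m, m₀ ≤ m → LargeLevel C m) (ω : Path) (n : ℕ) :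
    |lowerBet ψ ε m₀ M ω n| * ω.c n ≤ ∑ p ∈ cycles ψ m₀ M,
      (if cyc ψ p.1 p.2 ≤ ω.Asq n ∧ ω.Asq n < cyc ψ p.1 (p.2 + 1)
        then ε / 2 * cycSum ψ p.1 p.2 ω n else 0) := by
  refine (abs_combBet_mul_c_le _ _ _ _ _ _ _).trans ?_
  rw [Finset.sum_sigma]
  refine Finset.sum_le_sum fun p hp => ?_
  have hpm : m₀ ≤ p.1 := (Finset.mem_Ico.1 (Finset.mem_sigma.1 hp).1).1
  split_ifs with h
  · rw [cycSum, Finset.mul_sum]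
    refine Finset.sum_le_sum fun k _ => ?_
    rw [abs_neg, abs_of_nonneg (mul_nonneg hε (Real.exp_pos _).le)]
    refine (mul_le_mul_of_nonneg_left (abs_expBet_mul_c_le _ _ _ _ _)
      (mul_nonneg hε (Real.exp_pos _).le)).trans (le_of_eq ?_)
    rw [cycCap]; ring
  · refine (Finset.sum_eq_zero fun k hk => ?_).le
    have hg : gate (√(p.1 + 1) / √(cycPt ψ p.1 p.2 k)) (cyc ψ p.1 p.2)
        (16 * cycPt ψ p.1 p.2 k) ω n = 0 := by
      refine if_neg fun h' => h ⟨h'.1, h'.2.1.trans ?_⟩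
      have h1 := cycPt_lt (q := p.2) hψ (hm₀ _ hpm) (Finset.mem_range.1 hk)
      linarith [cycPt_pos hψ p.1 p.2 k]
    simp [expBet, hg]

/-- Cycles not yet begun contribute `0`, finished ones a gain, and the single one under way a loss
of at most `B`; the scale `1 / (2 B)` turns this into `1 / 2`. -/
lemma wealth_lowerBet_ge (hcont : ContinuousOn ψ (Set.Ici 1))
    (hmono : MonotoneOn ψ (Set.Ici 1)) (hpos : ∀ t ∈ Set.Ici (1 : ℝ), 0 < ψ t)
    (hψ : Tendsto ψ atTop atTop) {C B : ℝ} (hC : 0 < C) (hB : 0 < B)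
    (hB' : ∀ {n₀ m q : ℕ} {ω : Path}, LargeLevel C m → LowerPath ψ C n₀ m ω →
      q < numCyc ψ m → ∀ n, cyc ψ m q ≤ ω.Asq n → cycSum ψ m q ω n ≤ B)
    {m₀ M n₀ : ℕ} (hm₀ : ∀ m, m₀ ≤ m → LargeLevel C m) {ω : Path}
    (hω : ∀ m, m₀ ≤ m → LowerPath ψ C n₀ m ω) (n : ℕ) :
    1 / 2 ≤ wealth 1 (lowerBet ψ (1 / (2 * B)) m₀ M) ω n := by
  have hsum : -B ≤ ∑ p ∈ cycles ψ m₀ M, (cost p.1 - cycSum ψ p.1 p.2 ω n) := by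
    have h1 := sum_cycles_ite_le hψ m₀ M (ω.Asq n) hB.le
    refine (neg_le_neg h1).trans ?_
    rw [← Finset.sum_neg_distrib]
    refine Finset.sum_le_sum fun p hp => ?_
    obtain ⟨hpm, hpq⟩ := Finset.mem_sigma.1 hp
    have hpm' := (Finset.mem_Ico.1 hpm).1
    have hpq' := Finset.mem_range.1 hpq
    have hc := cost_nonneg p.1
    rcases lt_or_ge (ω.Asq n) (cyc ψ p.1 p.2) with h | h
    · rw [if_neg (fun h' => h.not_ge h'.1), cycSum_eq_cost h]; simp
    · rcases lt_or_ge (ω.Asq n) (cyc ψ p.1 (p.2 + 1)) with h2 | h2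
      · rw [if_pos ⟨h, h2⟩]
        linarith [hB' (hm₀ _ hpm') (hω _ hpm') hpq' n h]
      · rw [if_neg (fun h' => h2.not_gt h'.2)]
        linarith [(hω _ hpm').cycSum_le_half_cost hcont hmono hpos hψ hC (hm₀ _ hpm') hpq' h2]
  rw [wealth_lowerBet]
  have h2 := mul_le_mul_of_nonneg_left hsum (by positivity : 0 ≤ 1 / (2 * B))
  have h3 : 1 / (2 * B) * -B = -(1 / 2) := by field_simp
  linarith

lemma lowerBet_prudent_on (hψ : Tendsto ψ atTop atTop) {C B : ℝ} (hB : 0 < B)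
    (hB' : ∀ {n₀ m q : ℕ} {ω : Path}, LargeLevel C m → LowerPath ψ C n₀ m ω →
      q < numCyc ψ m → ∀ n, cyc ψ m q ≤ ω.Asq n → cycSum ψ m q ω n ≤ B)
    {m₀ M n₀ : ℕ} (hm₀ : ∀ m, m₀ ≤ m → LargeLevel C m) {ω : Path}
    (hω : ∀ m, m₀ ≤ m → LowerPath ψ C n₀ m ω) (n : ℕ) :
    |lowerBet ψ (1 / (2 * B)) m₀ M ω n| * ω.c n ≤ 1 / 2 := by
  have hε : 0 ≤ 1 / (2 * B) := by positivity
  refine (abs_lowerBet_mul_c_le hψ hε hm₀ ω n).trans ?_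
  refine le_trans (Finset.sum_le_sum fun p hp => ?_)
    (sum_cycles_ite_le hψ m₀ M (ω.Asq n) (by norm_num : (0 : ℝ) ≤ 1 / 2))
  obtain ⟨hpm, hpq⟩ := Finset.mem_sigma.1 hp
  have hpm' := (Finset.mem_Ico.1 hpm).1
  split_ifs with h
  · have h1 := hB' (hm₀ _ hpm') (hω _ hpm') (Finset.mem_range.1 hpq) n h.1
    have h2 := mul_le_mul_of_nonneg_left h1 (by positivity : 0 ≤ 1 / (2 * B) / 2)
    have h3 : 1 / (2 * B) / 2 * B = 1 / 4 := by field_simp; norm_num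
    linarith
  · exact le_rfl

theorem canForce_lower {α : ℝ} (hα : 0 < α) (hcont : ContinuousOn ψ (Set.Ici 1))
    (hmono : MonotoneOn ψ (Set.Ici 1)) (hpos : ∀ t ∈ Set.Ici (1 : ℝ), 0 < ψ t)
    (hψ : Tendsto ψ atTop atTop) (hI : integralI ψ = ⊤) :
    CanForce α (fun ω => Regular ψ ω →
      ∃ᶠ n in atTop, ω.A n * ψ (ω.Asq n) ≤ ω.S n) := by
  suffices h : CanForce (α / 2) (fun ω => Regular ψ ω →
      (∀ᶠ m in atTop, CycleStartBound ψ m ω) →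
      ∃ᶠ n in atTop, ω.A n * ψ (ω.Asq n) ≤ ω.S n) from
    ((canForce_cycleStartBound (half_pos hα) hcont hmono hpos hψ).and h).mono
      fun ω hω hreg => hω.2 hreg (hω.1 hreg)
  have hdiv := not_summable_numCyc_mul_cost hψ
    (not_summable_of_integralI_eq_top hcont hmono hpos hψ hI)
  have hC : ∀ r : ℕ, (0 : ℝ) < r + 1 := fun r => by positivity
  -- The constant of a regular path is unknown, so strategy `r` is built for `C = r + 1` and works
  -- for all large `r`. It starts at a level `m₀ r ≥ r`, beyond whatever finite beginning of the
  -- path must be ignored.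
  choose B hB0 hB using fun r : ℕ => exists_cycSum_le hcont hmono hpos hψ (hC r)
  choose m₀ hm₀ using fun r : ℕ => eventually_atTop.1
    ((eventually_largeLevel ((r : ℝ) + 1)).and (eventually_ge_atTop r))
  -- Half of the sold cost is gained and scaled by `1 / (2 B r)`, so `4 * B r * 4 ^ r` yields the
  -- target `4 ^ r`.
  choose M hM1 hM2 using fun r : ℕ =>
    exists_le_sum_numCyc_mul_cost hdiv (m₀ r) (4 * B r * 4 ^ r)
  refine canForce_of_hits (half_pos hα) (fun r => lowerBet ψ (1 / (2 * B r)) (m₀ r) (M r))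
    (fun r => combBet_predictable _ _ _ _ _) (fun r => (1 / 2) ^ r) (fun r => 4 ^ r)
    (fun r => by positivity) summable_geometric_two ?_ ?_
  · refine (tendsto_pow_atTop_atTop_of_one_lt (one_lt_two (α := ℝ))).congr fun r => ?_
    rw [← mul_pow]; norm_num
  · intro ω hω
    push Not at hω
    obtain ⟨hreg, hlow, hev⟩ := hω
    obtain ⟨C, -, n₁, hn₁⟩ := hreg.exists_bounds hmono hψ
    obtain ⟨n₂, hn₂⟩ := eventually_atTop.1 hev
    set n₀ := max n₁ n₂ with hn₀
    obtain ⟨m₁, hm₁⟩ := eventually_atTop.1 (hlow.and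
      ((tendsto_thr hcont hmono hpos hψ).eventually_gt_atTop (ω.Asq n₀)))
    refine Eventually.frequently ?_
    filter_upwards [tendsto_natCast_atTop_atTop.eventually_ge_atTop C, eventually_ge_atTop m₁]
      with r hr1 hr2
    have hpath : ∀ m, m₀ r ≤ m → LowerPath ψ (r + 1) n₀ m ω := by
      intro m hm
      have hrm : r ≤ m := (hm₀ r m hm).2
      obtain ⟨h1, h2⟩ := hm₁ m (hr2.trans hrm)
      refine ⟨fun i hi => ?_, fun n hn => hn₂ n ((le_max_right _ _).trans hn), h2, h1⟩
      obtain ⟨k1, k2, k3⟩ := hn₁ i ((le_max_left _ _).trans hi)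
      refine ⟨k1, k2.trans (mul_le_mul_of_nonneg_right ?_ (Real.sqrt_nonneg _)), k3⟩
      linarith
    have hlarge : ∀ m, m₀ r ≤ m → LargeLevel ((r : ℝ) + 1) m := fun m hm => (hm₀ r m hm).1
    obtain ⟨n, hn⟩ := (hreg.1.eventually_ge_atTop (thr ψ (M r))).exists
    refine ⟨n, ?_, fun i _ =>
      (lowerBet_prudent_on hψ (hB0 r) (hB r) hlarge hpath i).trans
        (wealth_lowerBet_ge hcont hmono hpos hψ (hC r) (hB0 r) (hB r) hlarge hpath i)⟩
    rw [wealth_lowerBet]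
    have hsum : (∑ m ∈ Finset.Ico (m₀ r) (M r), numCyc ψ m * cost m) / 2 ≤
        ∑ p ∈ cycles ψ (m₀ r) (M r), (cost p.1 - cycSum ψ p.1 p.2 ω n) := by
      rw [cycles, Finset.sum_sigma, Finset.sum_div]
      refine Finset.sum_le_sum fun m hm => ?_
      obtain ⟨hm1, hm2⟩ := Finset.mem_Ico.1 hm
      have e : (numCyc ψ m : ℝ) * cost m / 2 =
          ∑ q ∈ Finset.range (numCyc ψ m), cost m / 2 := by
        rw [Finset.sum_const, Finset.card_range, nsmul_eq_mul]; ring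
      rw [e]
      refine Finset.sum_le_sum fun q hq => ?_
      have hq' := Finset.mem_range.1 hq
      have h1 : cyc ψ m (q + 1) ≤ ω.Asq n :=
        (cyc_le_thr_succ hψ hq').trans ((thr_mono hψ hm2).trans hn)
      have h2 := (hpath m hm1).cycSum_le_half_cost hcont hmono hpos hψ (hC r)
        (hlarge m hm1) hq' h1
      linarith
    have hb := hB0 r
    have h3 : 2 * B r * 4 ^ r ≤
        ∑ p ∈ cycles ψ (m₀ r) (M r), (cost p.1 - cycSum ψ p.1 p.2 ω n) := by
      linarith [hM2 r]
    have h4 := mul_le_mul_of_nonneg_left h3 (by positivity : 0 ≤ 1 / (2 * B r))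
    have h5 : 1 / (2 * B r) * (2 * B r * 4 ^ r) = 4 ^ r := by field_simp
    linarith

end Lower

end SPUFG

theorem theorem2 (α : ℝ) (hα : 0 < α) (ψ : ℝ → ℝ)
    (hcont : ContinuousOn ψ (Set.Ici 1)) (hmono : MonotoneOn ψ (Set.Ici 1))
    (hpos : ∀ t ∈ Set.Ici (1 : ℝ), 0 < ψ t) :
    (SPUFG.integralI ψ < ⊤ →
      SPUFG.CanForce α (fun ω => SPUFG.Regular ψ ω →
        ∀ᶠ n in Filter.atTop, ω.S n < ω.A n * ψ (ω.Asq n))) ∧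
    (SPUFG.integralI ψ = ⊤ → Filter.Tendsto ψ Filter.atTop Filter.atTop →
      SPUFG.CanForce α (fun ω => SPUFG.Regular ψ ω →
        ∃ᶠ n in Filter.atTop, ω.A n * ψ (ω.Asq n) ≤ ω.S n)) :=
  ⟨fun hI => SPUFG.canForce_upper hα hcont hmono hpos hI,
   fun hI hψ => SPUFG.canForce_lower hα hcont hmono hpos hψ hI⟩
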